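/- Let $\beta>2$ and $c_I>4$. There is a constant $C_\beta>0$, depending only on $\beta$ and $c_I$, such that the following holds for all integers $n\ge 1$, $r\ge 1$ and all real $\mu$ with $1\le\mu\le n/r$. Let $\mathbf P^\star\in\mathbb R^{n\times r}$ have full column rank and satisfy $\mathbf P^{\star T}\mathbf 1=\mathbf 0$. Let $\mathbf P^\star\mathbf P^{\star T}=\mathbf U^\star\boldsymbol\Sigma^\star\mathbf U^{\star T}$ be a rank-$r$ thin singular value decomposition, with $\boldsymbol\Sigma^\star=\mathrm{diag}(\sigma_1^\star,\dots,\sigma_r^\star)$ and $\sigma_1^\star\ge\dots\ge\sigma_r^\star>0$, and put $\kappa=\sigma_1^\star/\sigma_r^\star$. Write $\|\cdot\|_{2,\infty}$ for the largest Euclidean norm of a row, and assume the incoherence conditions $$\|\mathbf U^\star\|_{2,\infty}\le\sqrt{\frac{\mu r}{n}},\qquad \|\mathbf P^\star\|_{2,\infty}\le\sqrt{\frac{\mu r\sigma_1^\star}{n}}.$$ Let $\mathbf D^\star_{ij}=\|\mathbf P^\star(i,:)-\mathbf P^\star(j,:)\|_2^2$. Let $(\delta_{ij})_{1\le i<j\le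 n}$ be i.i.d. $0/1$ Bernoulli random variables with $\mathbb P(\delta_{ij}=1)=p$, and let $\mathcal P_\Omega\mathbf D^\star$ be the symmetric matrix with zero diagonal and with entries $(i,j)$ and $(j,i)$ equal to $\delta_{ij}\mathbf D^\star_{ij}$ for $i<j$. Let $\mathbf J=\mathbf I-\frac1n\mathbf 1\mathbf 1^T$, and let $\mathcal T_r$ denote the rank-$r$ SVD truncation (all but the $r$ largest singular values are replaced by $0$). For $\mathbf P\in\mathbb R^{n\times r}$ let $\mathcal P_I(\mathbf P)$ be the matrix obtained from $\mathbf P$ by rescaling every row of Euclidean norm greater than $\sqrt{\mu r\sigma_1^\star/n}$ to have norm $\sqrt{\mu r\sigma_1^\star/n}$. Finally, let $$\mathcal B=\Big\{\mathbf P\in\mathbb R^{n\times r}:\ \|\Delta\|_{2,\infty}\le\sqrt{\frac{c_I\mu r\sigma_1^\star}{n}},\ \ \|\Delta\|_F^2\le\frac{\sigma_r^\star}{c_c}\Big\},\qquad c_c=\frac{80}{7},$$ where $\Delta=\mathbf P-\mathbf P^\star\boldsymbol\psi^\star$ and $\boldsymbol\psi^\star$ minimizes $\|\mathbf P-\mathbf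 P^\star\boldsymbol\psi\|_F$ over the orthogonal group $O(r)$. If $$p\ \ge\ C_\beta\,\frac{\mu^2r^3\kappa^2\log n}{n},$$ then, with probability at least $1-n^{1-\beta}$, the following holds for every choice of the truncation $\mathcal T_r\big[-\frac1{2p}\mathbf J(\mathcal P_\Omega\mathbf D^\star)\mathbf J\big]$: it can be factored as $$\hat{\mathbf P}\hat{\mathbf P}^T=\mathcal T_r\Big[-\frac1{2p}\mathbf J(\mathcal P_\Omega\mathbf D^\star)\mathbf J\Big],\qquad \hat{\mathbf P}\in\mathbb R^{n\times r},$$ and for every such factor $\hat{\mathbf P}$ the trimmed matrix $\mathbf P_1=\mathcal P_I(\hat{\mathbf P})$ belongs to $\mathcal B$. -/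

import Mathlib

open MeasureTheory ProbabilityTheory

noncomputable section

namespace EDMC

/-- The index set of unordered pairs, represented by `(i, j)` with `i < j`. -/
abbrev Pairs (n : ℕ) : Type := {a : Fin n × Fin n // a.1 < a.2}

/-- The Euclidean norm of the `i`-th row of `A`. -/
def rowNorm {n r : ℕ} (A : Matrix (Fin n) (Fin r) ℝ) (i : Fin n) : ℝ :=
  Real.sqrt (∑ k, A i k ^ 2)

/-- The row-wise norm `‖A‖_{2,∞}`: the largest Euclidean norm of a row. -/
def normTwoInf {n r : ℕ} (A : Matrix (Fin n) (Fin r) ℝ) : ℝ :=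
  ⨆ i, rowNorm A i

/-- The squared Frobenius norm. -/
def frobSq {n r : ℕ} (A : Matrix (Fin n) (Fin r) ℝ) : ℝ :=
  ∑ i, ∑ k, A i k ^ 2

/-- The Euclidean distance matrix (squared distances) of the points in the rows of `P`. -/
def edm {n r : ℕ} (P : Matrix (Fin n) (Fin r) ℝ) : Matrix (Fin n) (Fin n) ℝ :=
  Matrix.of fun i j => ∑ k, (P i k - P j k) ^ 2

/-- The centering matrix `J = I - (1/n) 1 1ᵀ`. -/
def centering (n : ℕ) : Matrix (Fin n) (Fin n) ℝ :=
  1 - (1 / (n : ℝ)) • Matrix.of fun _ _ => (1 : ℝ)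

/-- The symmetric sampling operator: the entries `(i, j)` and `(j, i)` of `D` are kept when the
pair is selected by `d`; all other entries, and the diagonal, are set to zero. -/
def sample {n : ℕ} (d : Pairs n → Bool) (D : Matrix (Fin n) (Fin n) ℝ) :
    Matrix (Fin n) (Fin n) ℝ :=
  ∑ a : Pairs n, (if d a = true then (1 : ℝ) else 0) •
    (Matrix.single a.1.1 a.1.2 (D a.1.1 a.1.2) + Matrix.single a.1.2 a.1.1 (D a.1.2 a.1.1))

/-- The matrix `-(1/(2p)) J (P_Ω D) J` to which the rank-`r` truncation is applied. -/
def oneStepMDS {n : ℕ} (p : ℝ) (d : Pairs n → Bool) (D : Matrix (Fin n) (Fin n) ℝ) :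
    Matrix (Fin n) (Fin n) ℝ :=
  (-(1 / (2 * p))) • (centering n * sample d D * centering n)

/-- `X = U diag(s) Vᵀ` is a singular value decomposition with singular values in
non-increasing order. -/
structure IsSVD {n : ℕ} (X U V : Matrix (Fin n) (Fin n) ℝ) (s : Fin n → ℝ) : Prop where
  left_orth : U ∈ Matrix.orthogonalGroup (Fin n) ℝ
  right_orth : V ∈ Matrix.orthogonalGroup (Fin n) ℝ
  sorted : Antitone s
  nonneg : ∀ i, 0 ≤ s i
  eq : X = U * Matrix.diagonal s * V.transpose

/-- `T` is a rank-`r` SVD truncation of `X`: some singular value decomposition of `X`, with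
all but the `r` largest singular values replaced by zero. (It is unique unless the `r`-th and
`(r+1)`-th singular values of `X` are equal and nonzero.) -/
def IsTruncation {n : ℕ} (r : ℕ) (X T : Matrix (Fin n) (Fin n) ℝ) : Prop :=
  ∃ (U V : Matrix (Fin n) (Fin n) ℝ) (s : Fin n → ℝ), IsSVD X U V s ∧
    T = U * Matrix.diagonal (fun i : Fin n => if (i : ℕ) < r then s i else 0) * V.transpose

/-- `G = U diag(σ) Uᵀ` is a thin singular value decomposition of the rank-`r` positive
semidefinite matrix `G`, with singular values in non-increasing order. -/
structure IsThinSVD {n r : ℕ} (G : Matrix (Fin n) (Fin n) ℝ) (U : Matrix (Fin n) (Fin r) ℝ)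
    (σ : Fin r → ℝ) : Prop where
  orth : U.transpose * U = 1
  sorted : Antitone σ
  pos : ∀ i, 0 < σ i
  eq : G = U * Matrix.diagonal σ * U.transpose

/-- The row-wise trimming step at level `t`: rows of norm greater than `t` are rescaled to
norm `t`. -/
def trim {n r : ℕ} (t : ℝ) (P : Matrix (Fin n) (Fin r) ℝ) : Matrix (Fin n) (Fin r) ℝ :=
  Matrix.of fun i k => if rowNorm P i ≤ t then P i k else P i k / rowNorm P i * t

/-- `ψ` solves the orthogonal Procrustes problem `min_{ψ ∈ O(r)} ‖P - Q ψ‖_F`. -/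
def IsProcrustes {n r : ℕ} (P Q : Matrix (Fin n) (Fin r) ℝ) (ψ : Matrix (Fin r) (Fin r) ℝ) :
    Prop :=
  ψ ∈ Matrix.orthogonalGroup (Fin r) ℝ ∧
    ∀ φ ∈ Matrix.orthogonalGroup (Fin r) ℝ, frobSq (P - Q * ψ) ≤ frobSq (P - Q * φ)

/-- The incoherence and contraction region around `Q`: with `Δ = P - Q ψ` for a Procrustes
solution `ψ`, one has `‖Δ‖_{2,∞} ≤ √(c_I μ r σ₁ / n)` and `‖Δ‖_F² ≤ σ_r / c_c`. -/
def region {n r : ℕ} (Q : Matrix (Fin n) (Fin r) ℝ) (cI cc μ σ₁ σr : ℝ) :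
    Set (Matrix (Fin n) (Fin r) ℝ) :=
  {P | ∃ ψ, IsProcrustes P Q ψ ∧
    normTwoInf (P - Q * ψ) ≤ Real.sqrt (cI * μ * r * σ₁ / n) ∧
    frobSq (P - Q * ψ) ≤ σr / cc}

end EDMC

end

/-! Let `Y = p⁻¹ P_Ω D - D` be the sampling noise (`noise`). Since `D = v 1ᵀ + 1 vᵀ - 2 P⋆P⋆ᵀ` and
`J` kills `1` and fixes `P⋆`, the one-step matrix `X` differs from the Gram matrix `G = P⋆P⋆ᵀ` by
`-½ J Y J` (`oneStepMDS_sub_gram`). The theorem follows from the single event `‖Y‖ ≤ σ_r / (7√r)`,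
with the norm expressed through quadratic forms (`QuadBound`).

Deterministic half (`trim_mem_region_of_quadBound`). With `ε = σ_r / (14√r)` and `‖X - G‖ ≤ ε`,
Weyl-type arguments give `s_i ≥ σ_r - ε > ε` for the `r` leading singular values of `X` and `s_i ≤
ε` for the others. Hence the kept part is positive semidefinite and factors, and `‖T - G‖ ≤ 2ε`. As
`T - G` has rank at most `2r`, its squared Frobenius norm is at most `8rε²`. Procrustes optimality
converts this into a bound on `‖P̂ - P⋆φ‖_F²` (`IsProcrustes.mul_frobSq_le`). Trimming is the
rowwise projection onto a ball containing the rows of `P⋆φ`, so it does not increase this distance.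

Probabilistic half (`prodExp_trace_noise_pow_le`). The moments `E tr Y^{2q}` are bounded by the
exchangeable-pairs method: resampling one bit bounds `E tr Y^{2q}` by `2q - 1` times the expected
trace of a variance matrix times `Y^{2q-2}`. For this sampling model the variance matrix is diagonal
and governed by vertex degrees, so a scalar Young inequality absorbs the power of `Y` and leaves
moments of binomial-type degrees. Markov's inequality with `q` about `β log n` gives failure
probability `n e^{-q} ≤ n^{1-β}`. -/

namespace EDMC

open Matrix

/-! ### Spectral decompositions and trace inequalities for symmetric matrices -/

section Spectral

variable {m : Type*} [Fintype m] [DecidableEq m]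

theorem isHermitian_eq_conj_diagonal {A : Matrix m m ℝ} (hH : A.IsHermitian) :
    ∃ U : Matrix m m ℝ, Uᵀ * U = 1 ∧ U * Uᵀ = 1 ∧ A = U * diagonal hH.eigenvalues * Uᵀ := by
  have h1 : (hH.eigenvectorUnitary : Matrix m m ℝ)ᵀ * hH.eigenvectorUnitary = 1 := by
    have := Unitary.coe_star_mul_self hH.eigenvectorUnitary
    rwa [star_eq_conjTranspose, conjTranspose_eq_transpose_of_trivial] at this
  refine ⟨hH.eigenvectorUnitary, h1, mul_eq_one_comm.mp h1, ?_⟩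
  have := hH.spectral_theorem
  rw [Unitary.conjStarAlgAut_apply, star_eq_conjTranspose,
    conjTranspose_eq_transpose_of_trivial] at this
  exact this

theorem exists_orthogonal_diagonalization {A : Matrix m m ℝ} (hA : A.IsSymm) :
    ∃ (U : Matrix m m ℝ) (l : m → ℝ), Uᵀ * U = 1 ∧ U * Uᵀ = 1 ∧ A = U * diagonal l * Uᵀ := by
  have hH : A.IsHermitian := by
    rw [Matrix.IsHermitian, conjTranspose_eq_transpose_of_trivial]; exact hA
  obtain ⟨U, hU⟩ := isHermitian_eq_conj_diagonal hH
  exact ⟨U, _, hU⟩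

theorem conj_diagonal_pow {U : Matrix m m ℝ} (hU : Uᵀ * U = 1) (hU' : U * Uᵀ = 1) (l : m → ℝ)
    (a : ℕ) : (U * diagonal l * Uᵀ) ^ a = U * diagonal (fun i => l i ^ a) * Uᵀ := by
  induction a with
  | zero => simp [hU']
  | succ a ih =>
    rw [pow_succ, ih]
    calc U * diagonal (fun i => l i ^ a) * Uᵀ * (U * diagonal l * Uᵀ)
        = U * diagonal (fun i => l i ^ a) * (Uᵀ * U) * diagonal l * Uᵀ := by
          simp only [Matrix.mul_assoc]
      _ = _ := by
          rw [hU, Matrix.mul_one, Matrix.mul_assoc U, diagonal_mul_diagonal]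
          simp only [pow_succ]

theorem trace_conj_diagonal_mul (U V : Matrix m m ℝ) (l k : m → ℝ) :
    trace (U * diagonal l * Uᵀ * (V * diagonal k * Vᵀ)) =
      ∑ i, ∑ j, l i * k j * ((Uᵀ * V) i j) ^ 2 := by
  have h1 : trace (U * diagonal l * Uᵀ * (V * diagonal k * Vᵀ)) =
      trace (diagonal l * (Uᵀ * V) * diagonal k * (Uᵀ * V)ᵀ) := by
    rw [transpose_mul, transpose_transpose]
    calc _ = trace (U * (diagonal l * Uᵀ * (V * diagonal k * Vᵀ))) := by
          simp only [Matrix.mul_assoc]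
      _ = _ := by rw [trace_mul_comm]; simp only [Matrix.mul_assoc]
  rw [h1]
  simp only [trace, diag_apply, Matrix.mul_apply (M := diagonal l * (Uᵀ * V) * diagonal k),
    mul_diagonal, diagonal_mul, transpose_apply]
  refine Finset.sum_congr rfl fun i _ => Finset.sum_congr rfl fun j _ => ?_
  ring

/-- The quotient of differences is a geometric sum of `2k + 1` monomials of degree `2k`, each at
most `max(|x|, |y|)^{2k}`. -/
theorem sub_mul_odd_pow_sub_le (x y : ℝ) (k : ℕ) :
    (x - y) * (x ^ (2 * k + 1) - y ^ (2 * k + 1)) ≤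
      (2 * k + 1) * ((x - y) ^ 2 * (x ^ (2 * k) + y ^ (2 * k))) := by
  have h1 : x ^ (2 * k + 1) - y ^ (2 * k + 1) =
      (∑ i ∈ Finset.range (2 * k + 1), x ^ i * y ^ (2 * k + 1 - 1 - i)) * (x - y) :=
    (geom_sum₂_mul x y _).symm
  have h2 : ∑ i ∈ Finset.range (2 * k + 1), x ^ i * y ^ (2 * k + 1 - 1 - i) ≤
      ∑ _i ∈ Finset.range (2 * k + 1), (x ^ (2 * k) + y ^ (2 * k)) := by
    refine Finset.sum_le_sum fun i hi => ?_
    have hi' : i + (2 * k + 1 - 1 - i) = 2 * k := by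
      have := Finset.mem_range.mp hi; omega
    have hev : Even (2 * k) := even_two_mul k
    have hM : x ^ i * y ^ (2 * k + 1 - 1 - i) ≤ (max |x| |y|) ^ (2 * k) := by
      calc x ^ i * y ^ (2 * k + 1 - 1 - i) ≤ |x ^ i * y ^ (2 * k + 1 - 1 - i)| := le_abs_self _
        _ = |x| ^ i * |y| ^ (2 * k + 1 - 1 - i) := by rw [abs_mul, abs_pow, abs_pow]
        _ ≤ (max |x| |y|) ^ i * (max |x| |y|) ^ (2 * k + 1 - 1 - i) := by
            gcongr
            · exact le_max_left _ _
            · exact le_max_right _ _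
        _ = _ := by rw [← pow_add, hi']
    have hx := hev.pow_nonneg x
    have hy := hev.pow_nonneg y
    rcases max_choice |x| |y| with h | h <;> rw [h, hev.pow_abs] at hM <;> linarith
  rw [Finset.sum_const, Finset.card_range, nsmul_eq_mul] at h2
  have h3 := mul_le_mul_of_nonneg_left h2 (sq_nonneg (x - y))
  rw [h1]
  refine le_trans (le_of_eq (by ring)) (h3.trans (le_of_eq ?_))
  push_cast; ring

/-- In eigenbases of `A` and `B`, every `tr(AᵃBᵇ)` is a sum of `l_i^a t_j^b` with the same
nonnegative weights `(UᵀV)_{ij}²`. Both sides only involve such traces, so the scalar inequality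
applies to each pair of eigenvalues, although `A` and `B` need not commute. -/
theorem trace_sub_mul_odd_pow_sub_le {A B : Matrix m m ℝ} (hA : A.IsSymm) (hB : B.IsSymm)
    (k : ℕ) :
    trace ((A - B) * (A ^ (2 * k + 1) - B ^ (2 * k + 1))) ≤
      (2 * k + 1) * trace ((A - B) * (A - B) * (A ^ (2 * k) + B ^ (2 * k))) := by
  obtain ⟨U, l, hU, hU', hAl⟩ := exists_orthogonal_diagonalization hA
  obtain ⟨V, t, hV, hV', hBt⟩ := exists_orthogonal_diagonalization hB
  have key : ∀ a b : ℕ, trace (A ^ a * B ^ b) =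
      ∑ i, ∑ j, l i ^ a * t j ^ b * ((Uᵀ * V) i j) ^ 2 := by
    intro a b
    rw [hAl, hBt, conj_diagonal_pow hU hU', conj_diagonal_pow hV hV', trace_conj_diagonal_mul]
  have e1 : trace ((A - B) * (A ^ (2 * k + 1) - B ^ (2 * k + 1))) =
      trace (A ^ (2 * k + 2) * B ^ 0) - trace (A ^ 1 * B ^ (2 * k + 1))
        - trace (A ^ (2 * k + 1) * B ^ 1) + trace (A ^ 0 * B ^ (2 * k + 2)) := by
    rw [Matrix.sub_mul, Matrix.mul_sub, Matrix.mul_sub]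
    simp only [trace_sub, pow_zero, pow_one, Matrix.mul_one, Matrix.one_mul]
    rw [trace_mul_comm B (A ^ (2 * k + 1)), ← pow_succ', ← pow_succ']
    ring
  have e2 : trace ((A - B) * (A - B) * (A ^ (2 * k) + B ^ (2 * k))) =
      trace (A ^ (2 * k + 2) * B ^ 0) - 2 * trace (A ^ (2 * k + 1) * B ^ 1)
        + trace (A ^ (2 * k) * B ^ 2) + trace (A ^ 2 * B ^ (2 * k))
        - 2 * trace (A ^ 1 * B ^ (2 * k + 1)) + trace (A ^ 0 * B ^ (2 * k + 2)) := by
    have hexp : (A - B) * (A - B) * (A ^ (2 * k) + B ^ (2 * k)) =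
        A ^ 2 * A ^ (2 * k) - A * (B * A ^ (2 * k)) - B * (A * A ^ (2 * k)) + B ^ 2 * A ^ (2 * k)
        + A ^ 2 * B ^ (2 * k) - A * (B * B ^ (2 * k)) - B * (A * B ^ (2 * k))
        + B ^ 2 * B ^ (2 * k) := by noncomm_ring
    rw [hexp]
    simp only [trace_add, trace_sub, pow_zero, pow_one, Matrix.mul_one, Matrix.one_mul]
    rw [trace_mul_comm A (B * A ^ (2 * k)), trace_mul_comm B (A * A ^ (2 * k)),
      trace_mul_comm (B ^ 2) (A ^ (2 * k)), trace_mul_comm B (A * B ^ (2 * k)),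
      Matrix.mul_assoc B, trace_mul_comm B (A ^ (2 * k) * A), Matrix.mul_assoc A (B ^ (2 * k)) B,
      ← pow_succ, ← pow_succ, ← pow_succ', ← pow_succ', ← pow_add, ← pow_add,
      show 2 + 2 * k = 2 * k + 2 by ring]
    ring
  rw [e1, e2]
  simp only [key, Finset.mul_sum, ← Finset.sum_sub_distrib, ← Finset.sum_add_distrib]
  refine Finset.sum_le_sum fun i _ => Finset.sum_le_sum fun j _ => ?_
  have := mul_le_mul_of_nonneg_right (sub_mul_odd_pow_sub_le (l i) (t j) k)
    (sq_nonneg ((Uᵀ * V) i j))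
  refine le_trans (le_of_eq ?_) (this.trans (le_of_eq ?_)) <;> ring

/-- The quadratic form of `M` is bounded in absolute value by `ε` times the squared norm. -/
def QuadBound (M : Matrix m m ℝ) (ε : ℝ) : Prop :=
  ∀ x : m → ℝ, |x ⬝ᵥ M *ᵥ x| ≤ ε * (x ⬝ᵥ x)

theorem dotProduct_mulVec_self_of_orth {U : Matrix m m ℝ} (hU : U * Uᵀ = 1) (x : m → ℝ) :
    (Uᵀ *ᵥ x) ⬝ᵥ (Uᵀ *ᵥ x) = x ⬝ᵥ x := by
  rw [dotProduct_mulVec, vecMul_transpose, mulVec_mulVec, hU, one_mulVec]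

theorem dotProduct_conj_diagonal_mulVec {c : Type*} [Fintype c] [DecidableEq c]
    (U V : Matrix m c ℝ) (l : c → ℝ) (x : m → ℝ) :
    x ⬝ᵥ (U * diagonal l * Vᵀ) *ᵥ x = ∑ i, l i * ((Uᵀ *ᵥ x) i * (Vᵀ *ᵥ x) i) := by
  rw [← mulVec_mulVec, ← mulVec_mulVec, dotProduct_mulVec, ← mulVec_transpose, dotProduct]
  refine Finset.sum_congr rfl fun i _ => ?_
  rw [mulVec_diagonal]; ring

theorem quadBound_of_trace_pow_le {A : Matrix m m ℝ} (hA : A.IsSymm) {τ : ℝ} (hτ : 0 ≤ τ) {k : ℕ}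
    (hk : k ≠ 0) (h : trace (A ^ (2 * k)) ≤ τ ^ (2 * k)) : QuadBound A τ := by
  obtain ⟨U, l, hU, hU', hAl⟩ := exists_orthogonal_diagonalization hA
  have htr : trace (A ^ (2 * k)) = ∑ i, l i ^ (2 * k) := by
    rw [hAl, conj_diagonal_pow hU hU', Matrix.mul_assoc, trace_mul_comm, Matrix.mul_assoc, hU,
      Matrix.mul_one, trace_diagonal]
  have hl : ∀ i, |l i| ≤ τ := by
    intro i
    have h1 : l i ^ (2 * k) ≤ τ ^ (2 * k) := by
      refine le_trans ?_ h
      rw [htr]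
      exact Finset.single_le_sum (f := fun i => l i ^ (2 * k))
        (fun j _ => (even_two_mul k).pow_nonneg _) (Finset.mem_univ i)
    rw [← (even_two_mul k).pow_abs] at h1
    exact le_of_pow_le_pow_left₀ (by omega) hτ h1
  intro x
  rw [hAl, dotProduct_conj_diagonal_mulVec, ← dotProduct_mulVec_self_of_orth hU' x, dotProduct,
    Finset.mul_sum]
  refine (Finset.abs_sum_le_sum_abs _ _).trans (Finset.sum_le_sum fun i _ => ?_)
  rw [abs_mul, abs_of_nonneg (mul_self_nonneg ((Uᵀ *ᵥ x) i))]
  exact mul_le_mul_of_nonneg_right (hl i) (mul_self_nonneg _)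

/-- Only the nonzero eigenvalues contribute, and the rank counts them; this is what makes the final
bound depend on `r` and not on `n`. -/
theorem trace_sq_le_of_quadBound {A : Matrix m m ℝ} (hA : A.IsSymm) {τ : ℝ}
    (h : QuadBound A τ) : trace (A * A) ≤ A.rank * τ ^ 2 := by
  have hH : A.IsHermitian := by
    rw [Matrix.IsHermitian, conjTranspose_eq_transpose_of_trivial]; exact hA
  obtain ⟨U, hU, hU', hAl⟩ := isHermitian_eq_conj_diagonal hH
  have htr : trace (A * A) = ∑ i, hH.eigenvalues i ^ 2 := by
    rw [← pow_two]
    conv_lhs => rw [hAl]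
    rw [conj_diagonal_pow hU hU', Matrix.mul_assoc, trace_mul_comm, Matrix.mul_assoc, hU,
      Matrix.mul_one, trace_diagonal]
  have hl : ∀ i, hH.eigenvalues i ^ 2 ≤ τ ^ 2 := by
    intro i
    have h1 := h (U *ᵥ Pi.single i 1)
    have h2 : Uᵀ *ᵥ (U *ᵥ Pi.single i 1) = Pi.single i 1 := by
      rw [mulVec_mulVec, hU, one_mulVec]
    conv_lhs at h1 => rw [hAl]
    rw [dotProduct_conj_diagonal_mulVec, ← dotProduct_mulVec_self_of_orth hU', h2] at h1
    simp [Pi.single_apply] at h1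
    exact sq_le_sq' (by linarith [neg_abs_le (hH.eigenvalues i)]) ((le_abs_self _).trans h1)
  rw [htr, hH.rank_eq_card_non_zero_eigs, Fintype.card_subtype]
  rw [← Finset.sum_filter_of_ne (p := fun i => hH.eigenvalues i ≠ 0)
    (fun i _ hi h0 => hi (by rw [h0]; norm_num)), ← nsmul_eq_mul]
  exact Finset.sum_le_card_nsmul _ _ _ fun i _ => hl i

end Spectral

/-! ### Finite product expectations and the exchangeable-pairs inequality -/

section ProductExpectation

variable {ι : Type*} [Fintype ι] [DecidableEq ι]

/-- The expectation of `f` under the product over `ι` of copies of the weight `w` on `Bool`. -/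
noncomputable def prodExp (w : Bool → ℝ) (f : (ι → Bool) → ℝ) : ℝ :=
  ∑ d, (∏ a, w (d a)) * f d

theorem prodExp_add (w : Bool → ℝ) (f g : (ι → Bool) → ℝ) :
    prodExp w (fun d => f d + g d) = prodExp w f + prodExp w g := by
  simp only [prodExp, mul_add, Finset.sum_add_distrib]

theorem prodExp_const_mul (w : Bool → ℝ) (c : ℝ) (f : (ι → Bool) → ℝ) :
    prodExp w (fun d => c * f d) = c * prodExp w f := by
  simp only [prodExp, Finset.mul_sum]
  exact Finset.sum_congr rfl fun d _ => by ring

theorem prodExp_sum {κ : Type*} (s : Finset κ) (w : Bool → ℝ) (f : κ → (ι → Bool) → ℝ) :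
    prodExp w (fun d => ∑ j ∈ s, f j d) = ∑ j ∈ s, prodExp w (f j) := by
  simp only [prodExp, Finset.mul_sum]
  exact Finset.sum_comm

theorem prodExp_mono {w : Bool → ℝ} (hw : ∀ b, 0 ≤ w b) {f g : (ι → Bool) → ℝ}
    (h : ∀ d, f d ≤ g d) : prodExp w f ≤ prodExp w g :=
  Finset.sum_le_sum fun d _ =>
    mul_le_mul_of_nonneg_left (h d) (Finset.prod_nonneg fun a _ => hw (d a))

theorem prodExp_prod (w : Bool → ℝ) (g : ι → Bool → ℝ) :
    prodExp w (fun d => ∏ a, g a (d a)) = ∏ a, ∑ b, w b * g a b := by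
  rw [Finset.prod_univ_sum]
  simp only [prodExp, ← Finset.prod_mul_distrib, Fintype.piFinset_univ]

theorem prod_update_mul (w : Bool → ℝ) (d : ι → Bool) (a : ι) (b : Bool) :
    (∏ c, w (Function.update d a b c)) * w (d a) = (∏ c, w (d c)) * w b := by
  rw [← Finset.mul_prod_erase Finset.univ (fun c => w (Function.update d a b c))
    (Finset.mem_univ a), ← Finset.mul_prod_erase Finset.univ (fun c => w (d c))
    (Finset.mem_univ a)]
  have : ∏ c ∈ Finset.univ.erase a, w (Function.update d a b c) =
      ∏ c ∈ Finset.univ.erase a, w (d c) :=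
    Finset.prod_congr rfl fun c hc => by
      rw [Function.update_of_ne (Finset.ne_of_mem_erase hc)]
  rw [this, Function.update_self]; ring

/-- Exchanging the coordinate `d a` with an independent copy `b` is a weight-preserving involution.
-/
theorem prodExp_resample (w : Bool → ℝ) (a : ι) (F : (ι → Bool) → Bool → ℝ) :
    prodExp w (fun d => ∑ b, w b * F d b) =
      prodExp w (fun d => ∑ b, w b * F (Function.update d a b) (d a)) := by
  simp only [prodExp, Finset.mul_sum, ← Finset.sum_product']
  refine Finset.sum_nbij' (fun x => (Function.update x.1 a x.2, x.1 a))
    (fun x => (Function.update x.1 a x.2, x.1 a)) (by simp) (by simp) (by simp) (by simp) ?_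
  rintro ⟨d, b⟩ -
  simp only [Function.update_idem, Function.update_self, Function.update_eq_self]
  rw [← mul_assoc, ← mul_assoc, prod_update_mul]

variable {m : Type*} [Fintype m] [DecidableEq m]

/-- As `Z` has mean zero, an independent copy `Z b` may be subtracted from `Z (d a)`. Averaging with
the exchanged configuration turns `Y^{2k+1}` into half the difference of the two odd powers, where
`trace_sub_mul_odd_pow_sub_le` applies; a second exchange merges the two terms on the right. -/
theorem prodExp_trace_mul_odd_pow_le {w : Bool → ℝ} (hw : ∀ b, 0 ≤ w b) (hw1 : ∑ b, w b = 1)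
    (a : ι) {Y : (ι → Bool) → Matrix m m ℝ} (hY : ∀ d, (Y d).IsSymm) {Z : Bool → Matrix m m ℝ}
    (hZ : ∑ b, w b • Z b = 0) (hYZ : ∀ d b, Y d - Y (Function.update d a b) = Z (d a) - Z b)
    (k : ℕ) :
    prodExp w (fun d => trace (Z (d a) * Y d ^ (2 * k + 1))) ≤
      (2 * k + 1) * prodExp w (fun d => ∑ b, w b *
        trace ((Z (d a) - Z b) * (Z (d a) - Z b) * Y d ^ (2 * k))) := by
  have h1 : ∀ d, trace (Z (d a) * Y d ^ (2 * k + 1)) =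
      ∑ b, w b * trace ((Z (d a) - Z b) * Y d ^ (2 * k + 1)) := by
    intro d
    have e : ∑ b, w b * trace (Z b * Y d ^ (2 * k + 1)) = 0 := by
      have : ∑ b, w b * trace (Z b * Y d ^ (2 * k + 1)) =
          trace ((∑ b, w b • Z b) * Y d ^ (2 * k + 1)) := by
        rw [Finset.sum_mul, trace_sum]
        simp only [smul_mul, trace_smul, smul_eq_mul]
      rw [this, hZ, Matrix.zero_mul, trace_zero]
    simp only [Matrix.sub_mul, trace_sub, mul_sub, Finset.sum_sub_distrib]
    rw [e, ← Finset.sum_mul, hw1]; ring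
  simp only [h1]
  have h2 := prodExp_resample w a
    (fun d b => trace ((Z (d a) - Z b) * Y d ^ (2 * k + 1)))
  have h3 := prodExp_resample w a
    (fun d b => trace ((Z (d a) - Z b) * (Z (d a) - Z b) * Y d ^ (2 * k)))
  simp only [Function.update_self] at h2 h3
  have h4 : prodExp w (fun d => ∑ b, w b * trace ((Z (d a) - Z b) * Y d ^ (2 * k + 1))) +
      prodExp w (fun d => ∑ b, w b *
        trace ((Z b - Z (d a)) * Y (Function.update d a b) ^ (2 * k + 1))) ≤
      (2 * k + 1) * (prodExp w (fun d => ∑ b, w b *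
        trace ((Z (d a) - Z b) * (Z (d a) - Z b) * Y d ^ (2 * k))) +
      prodExp w (fun d => ∑ b, w b *
        trace ((Z b - Z (d a)) * (Z b - Z (d a)) * Y (Function.update d a b) ^ (2 * k)))) := by
    rw [← prodExp_add, ← prodExp_add, ← prodExp_const_mul]
    refine prodExp_mono hw fun d => ?_
    rw [← Finset.sum_add_distrib, ← Finset.sum_add_distrib, Finset.mul_sum]
    refine Finset.sum_le_sum fun b _ => ?_
    have h5 := mul_le_mul_of_nonneg_left
      (trace_sub_mul_odd_pow_sub_le (hY d) (hY (Function.update d a b)) k) (hw b)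
    rw [hYZ] at h5
    refine le_trans (le_of_eq ?_) (h5.trans (le_of_eq ?_))
    · rw [Matrix.mul_sub, trace_sub, ← neg_sub (Z (d a)) (Z b), Matrix.neg_mul, trace_neg]; ring
    · rw [Matrix.mul_add, trace_add, ← neg_sub (Z (d a)) (Z b), neg_mul_neg]; ring
  rw [← h2, ← h3] at h4
  linarith

theorem prodExp_trace_sum_pow_le {w : Bool → ℝ} (hw : ∀ b, 0 ≤ w b) (hw1 : ∑ b, w b = 1)
    {Z : ι → Bool → Matrix m m ℝ} (hZs : ∀ a b, (Z a b).IsSymm) (hZ : ∀ a, ∑ b, w b • Z a b = 0)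
    (k : ℕ) :
    prodExp w (fun d => trace ((∑ a, Z a (d a)) ^ (2 * k + 2))) ≤
      (2 * k + 1) * prodExp w (fun d => ∑ a, ∑ b, w b *
        trace ((Z a (d a) - Z a b) * (Z a (d a) - Z a b) * (∑ a, Z a (d a)) ^ (2 * k))) := by
  have hY : ∀ d : ι → Bool, (∑ a, Z a (d a)).IsSymm := by
    intro d
    rw [Matrix.IsSymm, transpose_sum]
    exact Finset.sum_congr rfl fun a _ => hZs a (d a)
  have h1 : ∀ d : ι → Bool, trace ((∑ a, Z a (d a)) ^ (2 * k + 2)) =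
      ∑ a, trace (Z a (d a) * (∑ a, Z a (d a)) ^ (2 * k + 1)) := by
    intro d
    rw [← trace_sum, ← Finset.sum_mul, ← pow_succ']
  simp only [h1]
  rw [prodExp_sum, prodExp_sum, Finset.mul_sum]
  refine Finset.sum_le_sum fun a _ => ?_
  refine prodExp_trace_mul_odd_pow_le hw hw1 a hY (hZ a) (fun d b => ?_) k
  rw [← Finset.sum_sub_distrib, Finset.sum_eq_single a]
  · rw [Function.update_self]
  · intro c _ hc
    rw [Function.update_of_ne hc, sub_self]
  · simp

end ProductExpectation

/-! ### Young's inequality against a diagonal matrix -/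

section Young

variable {m : Type*} [Fintype m] [DecidableEq m]

theorem mul_pow_le_half_add {b x : ℝ} (hb : 0 ≤ b) (hx : 0 ≤ x) (k : ℕ) :
    b * x ^ k ≤ 1 / 2 * x ^ (k + 1) + 1 / 2 * (2 * b) ^ (k + 1) := by
  rcases le_total (2 * b) x with h | h
  · have h1 : 2 * b * x ^ k ≤ x * x ^ k := by gcongr
    have h2 : 0 ≤ (2 * b) ^ (k + 1) := by positivity
    rw [pow_succ' x]; linarith
  · have h1 : b * x ^ k ≤ b * (2 * b) ^ k := by gcongr
    have h2 : 0 ≤ x ^ (k + 1) := by positivity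
    rw [pow_succ' (2 * b)]; linarith

/-- In an eigenbasis, each diagonal entry of `Y^{2k}` is an average of `(l_j²)^k` with weights
`U_{ij}²` summing to one, so the scalar inequality suffices. The coefficient `1/2` lets the trace on
the right be absorbed later. -/
theorem sum_mul_pow_diag_le {Y : Matrix m m ℝ} (hY : Y.IsSymm) {b : m → ℝ} (hb : ∀ i, 0 ≤ b i)
    (k : ℕ) :
    ∑ i, b i * (Y ^ (2 * k)) i i ≤
      1 / 2 * trace (Y ^ (2 * k + 2)) + 1 / 2 * ∑ i, (2 * b i) ^ (k + 1) := by
  obtain ⟨U, l, hU, hU', hYl⟩ := exists_orthogonal_diagonalization hY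
  have hd : ∀ (c : ℕ) (i : m), (Y ^ (2 * c)) i i = ∑ j, U i j ^ 2 * (l j ^ 2) ^ c := by
    intro c i
    rw [hYl, conj_diagonal_pow hU hU', Matrix.mul_apply]
    refine Finset.sum_congr rfl fun j _ => ?_
    rw [mul_diagonal, transpose_apply, pow_mul]; ring
  have h1 : ∀ i, ∑ j, U i j ^ 2 = 1 := by
    intro i
    have := congrFun (congrFun hU' i) i
    rw [Matrix.mul_apply, one_apply_eq] at this
    rw [← this]
    exact Finset.sum_congr rfl fun j _ => by rw [transpose_apply, pow_two]
  rw [show 2 * k + 2 = 2 * (k + 1) by ring, trace, Finset.mul_sum, Finset.mul_sum,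
    ← Finset.sum_add_distrib]
  refine Finset.sum_le_sum fun i _ => ?_
  rw [diag_apply, hd, hd]
  calc b i * ∑ j, U i j ^ 2 * (l j ^ 2) ^ k
      = ∑ j, U i j ^ 2 * (b i * (l j ^ 2) ^ k) := by
        rw [Finset.mul_sum]; exact Finset.sum_congr rfl fun j _ => by ring
    _ ≤ ∑ j, U i j ^ 2 * (1 / 2 * (l j ^ 2) ^ (k + 1) + 1 / 2 * (2 * b i) ^ (k + 1)) :=
        Finset.sum_le_sum fun j _ => mul_le_mul_of_nonneg_left
          (mul_pow_le_half_add (hb i) (sq_nonneg _) k) (sq_nonneg _)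
    _ = 1 / 2 * ∑ j, U i j ^ 2 * (l j ^ 2) ^ (k + 1) +
          (∑ j, U i j ^ 2) * (1 / 2 * (2 * b i) ^ (k + 1)) := by
        rw [Finset.mul_sum, Finset.sum_mul, ← Finset.sum_add_distrib]
        exact Finset.sum_congr rfl fun j _ => by ring
    _ = _ := by rw [h1, one_mul]

theorem pow_even_diag_nonneg {Y : Matrix m m ℝ} (hY : Y.IsSymm) (k : ℕ) (i : m) :
    0 ≤ (Y ^ (2 * k)) i i := by
  have hs : (Y ^ k)ᵀ = Y ^ k := by rw [transpose_pow, hY.eq]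
  rw [two_mul, pow_add]
  nth_rewrite 2 [← hs]
  rw [Matrix.mul_apply]
  exact Finset.sum_nonneg fun j _ => mul_self_nonneg _

end Young

/-! ### Moments of the sampling noise -/

section Sampling

/-- The Bernoulli weight with success probability `p`. -/
def bernWeight (p : ℝ) (b : Bool) : ℝ := if b then p else 1 - p

/-- The value of a bit as a real number. -/
def bitVal (b : Bool) : ℝ := if b then 1 else 0

/-- The symmetric elementary matrix supported on the two positions of a pair. -/
def pairMatrix {n : ℕ} (a : Pairs n) : Matrix (Fin n) (Fin n) ℝ :=
  Matrix.single a.1.1 a.1.2 1 + Matrix.single a.1.2 a.1.1 1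

/-- The contribution of the pair `a`, with sampling bit `b`, to `p⁻¹ P_Ω D - D`. -/
noncomputable def noiseTerm {n : ℕ} (p : ℝ) (D : Matrix (Fin n) (Fin n) ℝ) (a : Pairs n) (b : Bool) :
    Matrix (Fin n) (Fin n) ℝ :=
  (D a.1.1 a.1.2 * (bitVal b / p - 1)) • pairMatrix a

/-- The sampling noise `p⁻¹ P_Ω D - D`. -/
noncomputable def noise {n : ℕ} (p : ℝ) (D : Matrix (Fin n) (Fin n) ℝ) (d : Pairs n → Bool) :
    Matrix (Fin n) (Fin n) ℝ :=
  ∑ a, noiseTerm p D a (d a)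

/-- Indicator of the index `i` being an endpoint of the pair `a`. -/
def incid {n : ℕ} (a : Pairs n) (i : Fin n) : ℝ := if a.1.1 = i ∨ a.1.2 = i then 1 else 0

/-- The number of sampled pairs at the index `i`. -/
def sampleDegree {n : ℕ} (d : Pairs n → Bool) (i : Fin n) : ℝ := ∑ a, incid a i * bitVal (d a)

variable {n : ℕ}

theorem pairMatrix_isSymm (a : Pairs n) : (pairMatrix a).IsSymm := by
  rw [Matrix.IsSymm, pairMatrix, transpose_add, transpose_single, transpose_single, add_comm]

theorem noiseTerm_isSymm (p : ℝ) (D : Matrix (Fin n) (Fin n) ℝ) (a : Pairs n) (b : Bool) :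
    (noiseTerm p D a b).IsSymm := by
  rw [Matrix.IsSymm, noiseTerm, transpose_smul, (pairMatrix_isSymm a).eq]

theorem noise_isSymm (p : ℝ) (D : Matrix (Fin n) (Fin n) ℝ) (d : Pairs n → Bool) :
    (noise p D d).IsSymm := by
  rw [Matrix.IsSymm, noise, transpose_sum]
  exact Finset.sum_congr rfl fun a _ => noiseTerm_isSymm p D a (d a)

theorem sum_bernWeight_smul_noiseTerm {p : ℝ} (hp : p ≠ 0) (D : Matrix (Fin n) (Fin n) ℝ)
    (a : Pairs n) : ∑ b, bernWeight p b • noiseTerm p D a b = 0 := by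
  simp only [Fintype.sum_bool, noiseTerm, smul_smul, ← add_smul, bernWeight, bitVal]
  convert zero_smul ℝ (pairMatrix a) using 2
  simp
  field_simp
  ring

/-- This makes the resampling variance of the noise a diagonal matrix, as `sum_mul_pow_diag_le`
requires. -/
theorem pairMatrix_mul_self (a : Pairs n) :
    pairMatrix a * pairMatrix a = Matrix.single a.1.1 a.1.1 1 + Matrix.single a.1.2 a.1.2 1 := by
  have h := a.2.ne
  have h' := a.2.ne'
  rw [pairMatrix, Matrix.add_mul, Matrix.mul_add, Matrix.mul_add, single_mul_single_same,
    single_mul_single_same, single_mul_single_of_ne _ _ _ _ h',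
    single_mul_single_of_ne _ _ _ _ h, mul_one]
  simp

theorem trace_pairMatrix_sq_mul (a : Pairs n) (M : Matrix (Fin n) (Fin n) ℝ) :
    trace (pairMatrix a * pairMatrix a * M) = ∑ i, incid a i * M i i := by
  have h := a.2.ne
  rw [pairMatrix_mul_self, Matrix.add_mul, trace_add]
  have hs : ∀ i, incid a i * M i i =
      (if a.1.1 = i then M i i else 0) + (if a.1.2 = i then M i i else 0) := by
    intro i
    unfold incid
    by_cases h1 : a.1.1 = i
    · have h2 : a.1.2 ≠ i := fun h2 => h (h1.trans h2.symm)
      simp [h1, h2]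
    · simp [h1]
  simp only [hs, Finset.sum_add_distrib, Finset.sum_ite_eq, Finset.mem_univ, if_true]
  simp [trace_single_mul]

theorem incid_nonneg (a : Pairs n) (i : Fin n) : 0 ≤ incid a i := by
  unfold incid; split_ifs <;> norm_num

theorem bitVal_nonneg (b : Bool) : 0 ≤ bitVal b := by
  unfold bitVal; split_ifs <;> norm_num

theorem sum_incid_le (i : Fin n) : ∑ a : Pairs n, incid a i ≤ 2 * n := by
  have h : ∀ a : Pairs n, incid a i ≤ (if a.1.1 = i then 1 else 0) + if a.1.2 = i then 1 else 0 := by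
    intro a
    unfold incid
    by_cases h1 : a.1.1 = i <;> by_cases h2 : a.1.2 = i <;> simp [h1, h2]
  have hc : ∀ s : Finset (Pairs n), ∀ g : Pairs n → Fin n, Set.InjOn g s → (s.card : ℝ) ≤ n := by
    intro s g hg
    have := Finset.card_le_card_of_injOn (t := Finset.univ) g (fun _ _ => Finset.mem_univ _) hg
    rw [Finset.card_univ, Fintype.card_fin] at this
    exact_mod_cast this
  calc ∑ a : Pairs n, incid a i
      ≤ ∑ a : Pairs n, (((if a.1.1 = i then 1 else 0) : ℝ) + if a.1.2 = i then 1 else 0) :=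
        Finset.sum_le_sum fun a _ => h a
    _ = ((Finset.univ.filter fun a : Pairs n => a.1.1 = i).card : ℝ) +
        ((Finset.univ.filter fun a : Pairs n => a.1.2 = i).card : ℝ) := by
        rw [Finset.sum_add_distrib, Finset.sum_boole, Finset.sum_boole]
    _ ≤ n + n := by
        refine add_le_add (hc _ (fun a => a.1.2) ?_) (hc _ (fun a => a.1.1) ?_)
        · intro a ha b hb hab
          simp only [Finset.coe_filter, Finset.mem_univ, true_and, Set.mem_ofPred_eq] at ha hb
          exact Subtype.ext (Prod.ext (ha.trans hb.symm) hab)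
        · intro a ha b hb hab
          simp only [Finset.coe_filter, Finset.mem_univ, true_and, Set.mem_ofPred_eq] at ha hb
          exact Subtype.ext (Prod.ext hab (ha.trans hb.symm))
    _ = 2 * n := by ring

/-- From `x ≤ L e^{x/L}` with `L = np`, the moment reduces to an exponential moment at `θ = q/L ≤
1`. The shift `2L` contributes `e^{2q}`, and the independent bits contribute at most `e^{4q}`. -/
theorem prodExp_sampleDegree_pow_le {p : ℝ} (hp : 0 < p) (hp1 : p ≤ 1) {q : ℕ} (hq : 0 < q)
    (hqL : (q : ℝ) ≤ n * p) (i : Fin n) :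
    prodExp (bernWeight p) (fun d : Pairs n → Bool => (sampleDegree d i + 2 * (n * p)) ^ q) ≤
      (n * p * Real.exp 6) ^ q := by
  set L : ℝ := n * p with hL
  have hq0 : (0 : ℝ) < q := by exact_mod_cast hq
  have hLpos : 0 < L := hq0.trans_le hqL
  have hw : ∀ b, 0 ≤ bernWeight p b := by
    intro b; unfold bernWeight; split_ifs <;> linarith
  set θ : ℝ := q / L with hθ
  have hθ0 : 0 ≤ θ := by positivity
  have hθ1 : θ ≤ 1 := (div_le_one hLpos).mpr hqL
  have hθL : θ * L = q := div_mul_cancel₀ _ hLpos.ne'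
  have hdeg : ∀ d : Pairs n → Bool, 0 ≤ sampleDegree d i := fun d =>
    Finset.sum_nonneg fun a _ => mul_nonneg (incid_nonneg a i) (bitVal_nonneg _)
  have h1 : ∀ d : Pairs n → Bool, (sampleDegree d i + 2 * L) ^ q ≤
      (L ^ q * Real.exp (2 * q)) * ∏ a, Real.exp (θ * (incid a i * bitVal (d a))) := by
    intro d
    have e1 : sampleDegree d i + 2 * L ≤ L * Real.exp ((sampleDegree d i + 2 * L) / L) := by
      have := Real.add_one_le_exp ((sampleDegree d i + 2 * L) / L)
      calc sampleDegree d i + 2 * L = L * ((sampleDegree d i + 2 * L) / L) := by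
            field_simp
        _ ≤ _ := by gcongr; linarith
    calc (sampleDegree d i + 2 * L) ^ q
        ≤ (L * Real.exp ((sampleDegree d i + 2 * L) / L)) ^ q :=
          pow_le_pow_left₀ (by linarith [hdeg d]) e1 q
      _ = _ := by
          rw [mul_pow, ← Real.exp_nat_mul, ← Real.exp_sum, ← Finset.mul_sum, mul_assoc,
            ← Real.exp_add]
          congr 2
          change _ = 2 * (q : ℝ) + θ * sampleDegree d i
          rw [hθ]; field_simp; ring
  refine (prodExp_mono hw h1).trans ?_
  rw [prodExp_const_mul, prodExp_prod _ (fun a b => Real.exp (θ * (incid a i * bitVal b)))]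
  have h2 : ∏ a : Pairs n, ∑ b, bernWeight p b * Real.exp (θ * (incid a i * bitVal b)) ≤
      ∏ a : Pairs n, Real.exp (2 * p * θ * incid a i) := by
    refine Finset.prod_le_prod (fun a _ => Finset.sum_nonneg fun b _ =>
      mul_nonneg (hw b) (Real.exp_pos _).le) fun a _ => ?_
    have hexp : Real.exp θ ≤ 1 + 2 * θ := by
      have := Real.abs_exp_sub_one_le (x := θ) (by rwa [abs_of_nonneg hθ0])
      rw [abs_of_nonneg hθ0] at this
      linarith [le_abs_self (Real.exp θ - 1)]
    have h3 := Real.add_one_le_exp (2 * p * θ)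
    have h4 : p * Real.exp θ ≤ p * (1 + 2 * θ) := by gcongr
    unfold incid
    split_ifs
    · simp [bernWeight, bitVal]; linarith
    · simp [bernWeight, bitVal]
  have h5 : ∏ a : Pairs n, Real.exp (2 * p * θ * incid a i) ≤ Real.exp (4 * q) := by
    rw [← Real.exp_sum, ← Finset.mul_sum, Real.exp_le_exp]
    calc 2 * p * θ * ∑ a : Pairs n, incid a i ≤ 2 * p * θ * (2 * n) := by
          gcongr; exact sum_incid_le i
      _ = 4 * (θ * L) := by rw [hL]; ring
      _ = 4 * q := by rw [hθL]
  calc L ^ q * Real.exp (2 * q) *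
        ∏ a : Pairs n, ∑ b, bernWeight p b * Real.exp (θ * (incid a i * bitVal b))
      ≤ L ^ q * Real.exp (2 * q) * Real.exp (4 * q) := by gcongr; exact h2.trans h5
    _ = (L * Real.exp 6) ^ q := by
        rw [mul_pow L, ← Real.exp_nat_mul, mul_assoc, ← Real.exp_add]; congr 2; ring

theorem sum_trace_noiseTerm_sub_sq_mul_le {p K : ℝ} (hp : 0 < p) (hp1 : p ≤ 1)
    {D : Matrix (Fin n) (Fin n) ℝ} (hD : ∀ i j, |D i j| ≤ K) (d : Pairs n → Bool)
    {M : Matrix (Fin n) (Fin n) ℝ} (hM0 : ∀ i, 0 ≤ M i i) :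
    ∑ a, ∑ b, bernWeight p b * trace ((noiseTerm p D a (d a) - noiseTerm p D a b) *
      (noiseTerm p D a (d a) - noiseTerm p D a b) * M) ≤
      ∑ i, K ^ 2 / p ^ 2 * (sampleDegree d i + 2 * (n * p)) * M i i := by
  have hw : ∀ b, 0 ≤ bernWeight p b := by
    intro b; unfold bernWeight; split_ifs <;> linarith
  calc ∑ a, ∑ b, bernWeight p b * trace ((noiseTerm p D a (d a) - noiseTerm p D a b) *
        (noiseTerm p D a (d a) - noiseTerm p D a b) * M)
      ≤ ∑ a : Pairs n, K ^ 2 / p ^ 2 * (bitVal (d a) + p) * ∑ i, incid a i * M i i := by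
        refine Finset.sum_le_sum fun a _ => ?_
        have e : ∀ b, trace ((noiseTerm p D a (d a) - noiseTerm p D a b) *
            (noiseTerm p D a (d a) - noiseTerm p D a b) * M) =
            (D a.1.1 a.1.2 ^ 2 / p ^ 2) * (bitVal (d a) - bitVal b) ^ 2 *
              ∑ i, incid a i * M i i := by
          intro b
          rw [noiseTerm, noiseTerm, ← sub_smul, smul_mul_smul_comm, Matrix.smul_mul, trace_smul,
            trace_pairMatrix_sq_mul, smul_eq_mul]
          ring
        simp only [e, ← mul_assoc]
        rw [← Finset.sum_mul]
        refine mul_le_mul_of_nonneg_right ?_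
          (Finset.sum_nonneg fun i _ => mul_nonneg (incid_nonneg a i) (hM0 i))
        have hDK : D a.1.1 a.1.2 ^ 2 / p ^ 2 ≤ K ^ 2 / p ^ 2 := by
          refine div_le_div_of_nonneg_right ?_ (by positivity)
          rw [← sq_abs]
          exact pow_le_pow_left₀ (abs_nonneg _) (hD _ _) 2
        -- The left side is `1 - p` for a sampled pair and `p` for an unsampled one.
        have hsum : ∑ b, bernWeight p b * (bitVal (d a) - bitVal b) ^ 2 ≤ bitVal (d a) + p := by
          cases d a <;> simp [bernWeight, bitVal]
          linarith
        have hsum0 : 0 ≤ ∑ b, bernWeight p b * (bitVal (d a) - bitVal b) ^ 2 :=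
          Finset.sum_nonneg fun b _ => mul_nonneg (hw b) (sq_nonneg _)
        calc ∑ b, bernWeight p b * (D a.1.1 a.1.2 ^ 2 / p ^ 2) * (bitVal (d a) - bitVal b) ^ 2
            = D a.1.1 a.1.2 ^ 2 / p ^ 2 *
                ∑ b, bernWeight p b * (bitVal (d a) - bitVal b) ^ 2 := by
              rw [Finset.mul_sum]; exact Finset.sum_congr rfl fun b _ => by ring
          _ ≤ _ := mul_le_mul hDK hsum hsum0 (by positivity)
    _ = ∑ i, K ^ 2 / p ^ 2 * (sampleDegree d i + p * ∑ a : Pairs n, incid a i) * M i i := by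
        simp only [sampleDegree, Finset.mul_sum, ← Finset.sum_add_distrib, Finset.sum_mul]
        rw [Finset.sum_comm]
        refine Finset.sum_congr rfl fun i _ => Finset.sum_congr rfl fun a _ => ?_
        ring
    _ ≤ _ := by
        refine Finset.sum_le_sum fun i _ => ?_
        refine mul_le_mul_of_nonneg_right (mul_le_mul_of_nonneg_left ?_ (by positivity)) (hM0 i)
        have := mul_le_mul_of_nonneg_left (sum_incid_le i) hp.le
        linarith

/-- The exchangeable-pairs bound and Young's inequality give `E ≤ E/2 + R/2`, hence `E ≤ R`, where
`R` only involves degree moments. -/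
theorem prodExp_trace_noise_pow_le {p K : ℝ} (hp : 0 < p) (hp1 : p ≤ 1)
    {D : Matrix (Fin n) (Fin n) ℝ} (hD : ∀ i j, |D i j| ≤ K) {q : ℕ} (hq : 0 < q)
    (hqL : (q : ℝ) ≤ n * p) :
    prodExp (bernWeight p) (fun d : Pairs n → Bool => trace (noise p D d ^ (2 * q))) ≤
      n * (4 * q * Real.exp 6 * K ^ 2 * n / p) ^ q := by
  obtain ⟨k, rfl⟩ : ∃ k, q = k + 1 := ⟨q - 1, by omega⟩
  have hw : ∀ b, 0 ≤ bernWeight p b := by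
    intro b; unfold bernWeight; split_ifs <;> linarith
  have hw1 : ∑ b, bernWeight p b = 1 := by simp [bernWeight]
  have hdeg : ∀ (d : Pairs n → Bool) i, 0 ≤ sampleDegree d i := fun d i =>
    Finset.sum_nonneg fun a _ => mul_nonneg (incid_nonneg a i) (bitVal_nonneg _)
  have hL : 0 ≤ (n : ℝ) * p := by positivity
  set E := prodExp (bernWeight p)
    (fun d : Pairs n → Bool => trace (noise p D d ^ (2 * (k + 1)))) with hE
  have h1 : E ≤ (2 * k + 1) * prodExp (bernWeight p) (fun d : Pairs n → Bool =>
      ∑ i, K ^ 2 / p ^ 2 * (sampleDegree d i + 2 * (n * p)) * (noise p D d ^ (2 * k)) i i) := by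
    refine (prodExp_trace_sum_pow_le hw hw1 (fun a b => noiseTerm_isSymm p D a b)
      (sum_bernWeight_smul_noiseTerm hp.ne' D) k).trans ?_
    refine mul_le_mul_of_nonneg_left (prodExp_mono hw fun d => ?_) (by positivity)
    exact sum_trace_noiseTerm_sub_sq_mul_le hp hp1 hD d
      (pow_even_diag_nonneg (noise_isSymm p D d) k)
  set c : ℝ := (2 * k + 1) * (K ^ 2 / p ^ 2) with hc
  have hc0 : 0 ≤ c := by positivity
  clear_value c
  have h2 : E ≤ 1 / 2 * E + 1 / 2 * prodExp (bernWeight p) (fun d : Pairs n → Bool =>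
      ∑ i, (2 * (c * (sampleDegree d i + 2 * (n * p)))) ^ (k + 1)) := by
    refine h1.trans ?_
    rw [hE, ← prodExp_const_mul, ← prodExp_const_mul, ← prodExp_const_mul, ← prodExp_add]
    refine prodExp_mono hw fun d => ?_
    refine le_trans (le_of_eq ?_) (sum_mul_pow_diag_le (noise_isSymm p D d)
      (b := fun i => c * (sampleDegree d i + 2 * (n * p)))
      (fun i => mul_nonneg hc0 (by linarith [hdeg d i])) k)
    rw [Finset.mul_sum]
    exact Finset.sum_congr rfl fun i _ => by rw [hc]; ring
  have h3 : E ≤ ∑ _i : Fin n, (2 * c) ^ (k + 1) * (n * p * Real.exp 6) ^ (k + 1) := by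
    have h4 : E ≤ prodExp (bernWeight p) (fun d : Pairs n → Bool =>
      ∑ i, (2 * (c * (sampleDegree d i + 2 * (n * p)))) ^ (k + 1)) := by linarith
    refine h4.trans ?_
    rw [prodExp_sum]
    refine Finset.sum_le_sum fun i _ => ?_
    have h5 : ∀ d : Pairs n → Bool, (2 * (c * (sampleDegree d i + 2 * (n * p)))) ^ (k + 1) =
        (2 * c) ^ (k + 1) * (sampleDegree d i + 2 * (n * p)) ^ (k + 1) := fun d => by
      rw [← mul_assoc, mul_pow]
    simp only [h5]
    rw [prodExp_const_mul]
    have h6 := prodExp_sampleDegree_pow_le hp hp1 hq hqL i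
    have h7 : 0 ≤ (2 * c) ^ (k + 1) := by positivity
    exact mul_le_mul_of_nonneg_left h6 h7
  have h4 : 2 * c * (n * p * Real.exp 6) ≤
      4 * ((k + 1 : ℕ) : ℝ) * Real.exp 6 * K ^ 2 * n / p := by
    have e1 : 2 * c * (n * p * Real.exp 6) =
        2 * (2 * k + 1) * (Real.exp 6 * K ^ 2 * n / p) := by rw [hc]; field_simp
    have h6 : 0 ≤ Real.exp 6 * K ^ 2 * n / p := by positivity
    rw [e1]
    calc 2 * (2 * k + 1) * (Real.exp 6 * K ^ 2 * n / p)
        ≤ 4 * ((k : ℝ) + 1) * (Real.exp 6 * K ^ 2 * n / p) :=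
          mul_le_mul_of_nonneg_right (by linarith) h6
      _ = _ := by push_cast; ring
  have h5 : 0 ≤ 2 * c * (n * p * Real.exp 6) := by positivity
  have h6 := pow_le_pow_left₀ h5 h4 (k + 1)
  refine h3.trans ?_
  rw [Finset.sum_const, Finset.card_univ, Fintype.card_fin, nsmul_eq_mul, ← mul_pow]
  exact mul_le_mul_of_nonneg_left h6 (Nat.cast_nonneg n)

end Sampling

/-! ### Singular values under perturbation and the rank-r truncation -/

section Truncation

theorem exists_mulVec_eq_zero_of_card_lt {a b : Type*} [Fintype a] [Fintype b] [DecidableEq b]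
    (M : Matrix a b ℝ) (h : Fintype.card a < Fintype.card b) : ∃ c : b → ℝ, c ≠ 0 ∧ M *ᵥ c = 0 := by
  have h1 : LinearMap.ker M.mulVecLin ≠ ⊥ := LinearMap.ker_ne_bot_of_finrank_lt (by simpa using h)
  obtain ⟨c, hc, hc0⟩ := (Submodule.ne_bot_iff _).mp h1
  exact ⟨c, hc0, by simpa using hc⟩

theorem orthogonalGroup_transpose_mul {m : Type*} [Fintype m] [DecidableEq m] {U : Matrix m m ℝ}
    (h : U ∈ Matrix.orthogonalGroup m ℝ) : Uᵀ * U = 1 ∧ U * Uᵀ = 1 := by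
  have := (Matrix.mem_orthogonalGroup_iff m ℝ).mp h
  exact ⟨mul_eq_one_comm.mp this, this⟩

theorem mem_orthogonalGroup_of_transpose_mul {m : Type*} [Fintype m] [DecidableEq m]
    {U : Matrix m m ℝ} (h : Uᵀ * U = 1) : U ∈ Matrix.orthogonalGroup m ℝ := by
  rw [Matrix.mem_orthogonalGroup_iff']
  exact h

variable {n r : ℕ}

/-- Sort an eigenbasis by decreasing absolute eigenvalue and move the signs into the right factor.
-/
theorem exists_isSVD {X : Matrix (Fin n) (Fin n) ℝ} (hX : X.IsSymm) :
    ∃ U V s, IsSVD X U V s := by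
  obtain ⟨W, l, hW, hW', hXl⟩ := exists_orthogonal_diagonalization hX
  set π := Tuple.sort (fun i => -|l i|) with hπ
  set e : Fin n → ℝ := fun i => if l (π i) < 0 then -1 else 1 with he
  have hU : (W.submatrix id π)ᵀ * W.submatrix id π = 1 := by
    have h1 := submatrix_mul_equiv Wᵀ W π (Equiv.refl _) π
    rw [hW, submatrix_one_equiv] at h1
    exact h1
  have hee : ∀ i, e i * e i = 1 := by intro i; simp only [he]; split_ifs <;> norm_num
  refine ⟨W.submatrix id π, W.submatrix id π * diagonal e, fun i => |l (π i)|,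
    mem_orthogonalGroup_of_transpose_mul hU, mem_orthogonalGroup_of_transpose_mul ?_, ?_,
    fun i => abs_nonneg _, ?_⟩
  · rw [transpose_mul, diagonal_transpose, Matrix.mul_assoc, ← Matrix.mul_assoc _ _ (diagonal e),
      hU, Matrix.one_mul, diagonal_mul_diagonal]
    simp only [hee, diagonal_one]
  · intro i j hij
    have := Tuple.monotone_sort (fun i => -|l i|) hij
    simpa using this
  · rw [transpose_mul, diagonal_transpose, Matrix.mul_assoc, ← Matrix.mul_assoc (diagonal _),
      diagonal_mul_diagonal]
    have h1 : (fun i => |l (π i)| * e i) = l ∘ π := by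
      funext i
      simp only [he, Function.comp]
      split_ifs with h
      · rw [abs_of_neg h]; ring
      · rw [abs_of_nonneg (not_lt.mp h), mul_one]
    rw [h1, hXl, ← Matrix.mul_assoc]
    ext a b
    rw [Matrix.mul_apply, Matrix.mul_apply]
    simp only [mul_diagonal, transpose_apply, submatrix_apply, id, Function.comp]
    exact (Equiv.sum_comp π (fun j => W a j * l j * W b j)).symm

variable {X G U V T : Matrix (Fin n) (Fin n) ℝ} {s : Fin n → ℝ} {U₀ : Matrix (Fin n) (Fin r) ℝ}
  {σ : Fin r → ℝ} {ε σr : ℝ}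

theorem IsThinSVD.quadForm_eq (hG : IsThinSVD G U₀ σ) (x : Fin n → ℝ) :
    x ⬝ᵥ G *ᵥ x = ∑ i, σ i * ((U₀ᵀ *ᵥ x) i * (U₀ᵀ *ᵥ x) i) := by
  rw [hG.eq, dotProduct_conj_diagonal_mulVec]

theorem IsThinSVD.quadBound_lower (hG : IsThinSVD G U₀ σ) (hE : QuadBound (X - G) ε)
    (x : Fin n → ℝ) : -ε * (x ⬝ᵥ x) ≤ x ⬝ᵥ X *ᵥ x := by
  have h1 := (abs_le.mp (hE x)).1
  have h2 : 0 ≤ x ⬝ᵥ G *ᵥ x := by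
    rw [hG.quadForm_eq]
    exact Finset.sum_nonneg fun i _ => mul_nonneg (hG.pos i).le (mul_self_nonneg _)
  rw [Matrix.sub_mulVec, dotProduct_sub] at h1
  linarith

theorem IsSVD.quadForm_eq (h : IsSVD X U V s) (x : Fin n → ℝ) :
    x ⬝ᵥ X *ᵥ x = ∑ i, s i * ((Uᵀ *ᵥ x) i * (Vᵀ *ᵥ x) i) := by
  rw [h.eq, dotProduct_conj_diagonal_mulVec]

/-- Left and right singular vectors of a symmetric matrix agree for singular values that are
larger than the absolute value of every negative eigenvalue. -/
theorem IsSVD.left_eq_right (h : IsSVD X U V s) (hX : X.IsSymm)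
    (hlow : ∀ x, -ε * (x ⬝ᵥ x) ≤ x ⬝ᵥ X *ᵥ x) {i : Fin n} (hi : ε < s i) (k : Fin n) :
    U k i = V k i := by
  obtain ⟨hU, -⟩ := orthogonalGroup_transpose_mul h.left_orth
  obtain ⟨hV, -⟩ := orthogonalGroup_transpose_mul h.right_orth
  have h1 : X * V = U * diagonal s := by
    rw [h.eq, Matrix.mul_assoc, hV, Matrix.mul_one]
  have h2 : X * U = V * diagonal s := by
    rw [← hX.eq, h.eq, transpose_mul, transpose_mul, transpose_transpose, diagonal_transpose,
      ← Matrix.mul_assoc, Matrix.mul_assoc, hU, Matrix.mul_one]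
  set x : Fin n → ℝ := fun k => U k i - V k i with hx
  -- The difference of the two singular vectors, if nonzero, would be an eigenvector with eigenvalue
  -- `-s i < -ε`, which `hlow` excludes.
  have h3 : X *ᵥ x = -(s i) • x := by
    funext k
    have e1 := congrFun (congrFun h1 k) i
    have e2 := congrFun (congrFun h2 k) i
    rw [Matrix.mul_apply, mul_diagonal] at e1 e2
    simp only [mulVec, dotProduct, hx, mul_sub, Finset.sum_sub_distrib, Pi.smul_apply, smul_eq_mul]
    rw [e1, e2]; ring
  have h4 := hlow x
  rw [h3, dotProduct_smul, smul_eq_mul] at h4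
  have h5 : 0 ≤ x ⬝ᵥ x := Finset.sum_nonneg fun i _ => mul_self_nonneg _
  have h6 : x ⬝ᵥ x = 0 := by nlinarith
  have h7 := congrFun (dotProduct_self_eq_zero.mp h6) k
  simp only [hx, Pi.zero_apply] at h7
  linarith

/-- Termwise `2|uv| ≤ u² + v²` and Parseval in both bases. The alternative in `ht` ignores
coefficients in directions orthogonal to `x`. -/
theorem sum_mul_mul_le_of_orth (hU : U * Uᵀ = 1) (hV : V * Vᵀ = 1) {c : ℝ} (t : Fin n → ℝ)
    (x : Fin n → ℝ) (ht : ∀ i, |t i| ≤ c ∨ (Vᵀ *ᵥ x) i = 0) (hc : 0 ≤ c) :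
    |∑ i, t i * ((Uᵀ *ᵥ x) i * (Vᵀ *ᵥ x) i)| ≤ c * (x ⬝ᵥ x) := by
  have h1 : c * (x ⬝ᵥ x) = ∑ i, c * (((Uᵀ *ᵥ x) i * (Uᵀ *ᵥ x) i + (Vᵀ *ᵥ x) i * (Vᵀ *ᵥ x) i) / 2) := by
    rw [← Finset.mul_sum, ← Finset.sum_div, Finset.sum_add_distrib]
    have e1 := dotProduct_mulVec_self_of_orth hU x
    have e2 := dotProduct_mulVec_self_of_orth hV x
    rw [dotProduct] at e1 e2
    rw [e1, e2]; ring
  rw [h1]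
  refine (Finset.abs_sum_le_sum_abs _ _).trans (Finset.sum_le_sum fun i _ => ?_)
  rw [abs_mul]
  have h2 : |(Uᵀ *ᵥ x) i * (Vᵀ *ᵥ x) i| ≤
      ((Uᵀ *ᵥ x) i * (Uᵀ *ᵥ x) i + (Vᵀ *ᵥ x) i * (Vᵀ *ᵥ x) i) / 2 := by
    rw [abs_le]
    constructor
    · nlinarith [sq_nonneg ((Uᵀ *ᵥ x) i + (Vᵀ *ᵥ x) i)]
    · nlinarith [sq_nonneg ((Uᵀ *ᵥ x) i - (Vᵀ *ᵥ x) i)]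
  rcases ht i with h | h
  · exact mul_le_mul h h2 (abs_nonneg _) hc
  · rw [h, mul_zero, abs_zero, mul_zero]
    exact mul_nonneg hc (by nlinarith [mul_self_nonneg ((Uᵀ *ᵥ x) i)])

/-- As `i < r`, some nonzero `x` in the range of `U₀` is orthogonal to the `i` right singular
vectors preceding `i`. There `G` is at least `σr` and `X` at most `s i`. -/
theorem IsSVD.sub_le_singular_value (h : IsSVD X U V s) (hG : IsThinSVD G U₀ σ)
    (hE : QuadBound (X - G) ε) (hσ : ∀ i, σr ≤ σ i) {i : Fin n} (hi : (i : ℕ) < r) :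
    σr - ε ≤ s i := by
  obtain ⟨-, hU⟩ := orthogonalGroup_transpose_mul h.left_orth
  obtain ⟨-, hV⟩ := orthogonalGroup_transpose_mul h.right_orth
  obtain ⟨c, hc0, hc⟩ := exists_mulVec_eq_zero_of_card_lt
    ((Vᵀ * U₀).submatrix (Subtype.val : {j : Fin n // j < i} → Fin n) id) (by
      rw [Fintype.card_subtype, Fintype.card_fin]
      have : (Finset.univ.filter fun j => j < i).card = i := by
        rw [← Fin.card_Iio]; congr 1; ext; simp
      rwa [this])
  set x := U₀ *ᵥ c with hx
  have hx1 : U₀ᵀ *ᵥ x = c := by rw [hx, mulVec_mulVec, hG.orth, one_mulVec]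
  have hx2 : x ⬝ᵥ x = c ⬝ᵥ c := by
    rw [hx, dotProduct_mulVec, ← mulVec_transpose, mulVec_mulVec, hG.orth, one_mulVec]
  have hcpos : 0 < c ⬝ᵥ c := by
    refine lt_of_le_of_ne (Finset.sum_nonneg fun i _ => mul_self_nonneg _) fun h0 => hc0 ?_
    exact dotProduct_self_eq_zero.mp h0.symm
  have hy : ∀ j, j < i → (Vᵀ *ᵥ x) j = 0 := by
    intro j hj
    have := congrFun hc ⟨j, hj⟩
    rw [hx, mulVec_mulVec]
    exact this
  have h1 : x ⬝ᵥ X *ᵥ x ≤ s i * (x ⬝ᵥ x) := by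
    rw [h.quadForm_eq]
    refine (le_abs_self _).trans (sum_mul_mul_le_of_orth hU hV s x (fun j => ?_) (h.nonneg i))
    rcases lt_or_ge j i with hj | hj
    · exact Or.inr (hy j hj)
    · left; rw [abs_of_nonneg (h.nonneg j)]; exact h.sorted hj
  have h2 : σr * (c ⬝ᵥ c) ≤ x ⬝ᵥ G *ᵥ x := by
    rw [hG.quadForm_eq, hx1, dotProduct, Finset.mul_sum]
    exact Finset.sum_le_sum fun j _ => mul_le_mul_of_nonneg_right (hσ j) (mul_self_nonneg _)
  have h3 := (abs_le.mp (hE x)).1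
  rw [Matrix.sub_mulVec, dotProduct_sub] at h3
  rw [hx2] at h1 h3
  by_contra! hlt
  nlinarith

/-- If `s i > ε`, then the `i + 1 > r` leading left and right singular vectors coincide, so `X ≥ s
i` on their span as a quadratic form. By dimension this span meets the kernel of `U₀ᵀ`, where `G`
vanishes. -/
theorem IsSVD.singular_value_le (h : IsSVD X U V s) (hX : X.IsSymm) (hG : IsThinSVD G U₀ σ)
    (hE : QuadBound (X - G) ε) {i : Fin n} (hi : r ≤ (i : ℕ)) : s i ≤ ε := by
  obtain ⟨hV', hV⟩ := orthogonalGroup_transpose_mul h.right_orth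
  by_contra! hlt
  have heq : ∀ j, j ≤ i → ∀ k, U k j = V k j := fun j hj =>
    h.left_eq_right hX (hG.quadBound_lower hE) (hlt.trans_le (h.sorted hj))
  obtain ⟨c, hc0, hc⟩ := exists_mulVec_eq_zero_of_card_lt
    (fromRows (U₀ᵀ * V) ((1 : Matrix (Fin n) (Fin n) ℝ).submatrix
      (Subtype.val : {j : Fin n // i < j} → Fin n) id)) (by
      rw [Fintype.card_sum, Fintype.card_subtype, Fintype.card_fin, Fintype.card_fin]
      have : (Finset.univ.filter fun j => i < j).card = n - 1 - i := by
        rw [← Fin.card_Ioi]; congr 1; ext; simp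
      rw [this]; omega)
  set x := V *ᵥ c with hx
  have hx1 : Vᵀ *ᵥ x = c := by rw [hx, mulVec_mulVec, hV', one_mulVec]
  have hx2 : x ⬝ᵥ x = c ⬝ᵥ c := by rw [← dotProduct_mulVec_self_of_orth hV x, hx1]
  have hcpos : 0 < c ⬝ᵥ c := by
    refine lt_of_le_of_ne (Finset.sum_nonneg fun i _ => mul_self_nonneg _) fun h0 => hc0 ?_
    exact dotProduct_self_eq_zero.mp h0.symm
  rw [fromRows_mulVec] at hc
  have hcG : U₀ᵀ *ᵥ x = 0 := by
    rw [hx, mulVec_mulVec]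
    funext j
    exact congrFun hc (Sum.inl j)
  have hcz : ∀ j, i < j → c j = 0 := by
    intro j hj
    have := congrFun hc (Sum.inr ⟨j, hj⟩)
    simpa [mulVec, dotProduct, one_apply] using this
  have h1 : s i * (c ⬝ᵥ c) ≤ x ⬝ᵥ X *ᵥ x := by
    rw [h.quadForm_eq, hx1, dotProduct, Finset.mul_sum]
    refine Finset.sum_le_sum fun j _ => ?_
    rcases lt_or_ge i j with hj | hj
    · rw [hcz j hj]; simp
    · have : (Uᵀ *ᵥ x) j = c j := by
        rw [← hx1]
        simp only [mulVec, dotProduct, transpose_apply, heq j hj]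
      rw [this]
      exact mul_le_mul_of_nonneg_right (h.sorted hj) (mul_self_nonneg _)
  have h2 : x ⬝ᵥ G *ᵥ x = 0 := by
    rw [hG.quadForm_eq, hcG]; simp
  have h3 := (abs_le.mp (hE x)).2
  rw [Matrix.sub_mulVec, dotProduct_sub, h2, hx2] at h3
  nlinarith

theorem sum_castLE_eq_sum_ite (hrn : r ≤ n) (f : Fin n → ℝ) :
    ∑ l : Fin r, f (Fin.castLE hrn l) = ∑ j : Fin n, if (j : ℕ) < r then f j else 0 := by
  rw [← Finset.sum_filter]
  refine Finset.sum_nbij (Fin.castLE hrn) (by simp) (fun a _ b _ hab => by simpa using hab) ?_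
    (fun _ _ => rfl)
  intro j hj
  simp only [Finset.coe_filter, Finset.mem_univ, true_and, Set.mem_ofPred_eq] at hj
  exact ⟨⟨j, hj⟩, by simp, rfl⟩

/-- The kept singular values exceed `ε`, so their left and right vectors agree and the truncation is
positive semidefinite. -/
theorem IsTruncation.exists_factor (hT : IsTruncation r X T) (hrn : r ≤ n) (hX : X.IsSymm)
    (hG : IsThinSVD G U₀ σ) (hE : QuadBound (X - G) ε) (hσ : ∀ i, σr ≤ σ i)
    (hεσ : 2 * ε < σr) : ∃ P : Matrix (Fin n) (Fin r) ℝ, P * Pᵀ = T := by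
  obtain ⟨U, V, s, h, rfl⟩ := hT
  refine ⟨Matrix.of fun k l => U k (Fin.castLE hrn l) * Real.sqrt (s (Fin.castLE hrn l)), ?_⟩
  ext a b
  rw [Matrix.mul_apply, Matrix.mul_apply]
  simp only [mul_diagonal, transpose_apply, of_apply]
  rw [sum_castLE_eq_sum_ite hrn (fun j => U a j * Real.sqrt (s j) * (U b j * Real.sqrt (s j)))]
  refine Finset.sum_congr rfl fun j _ => ?_
  split_ifs with hj
  · have h1 := h.sub_le_singular_value hG hE hσ hj
    have h2 := h.left_eq_right hX (hG.quadBound_lower hE) (i := j) (by linarith) b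
    rw [h2, mul_mul_mul_comm, Real.mul_self_sqrt (h.nonneg j)]; ring
  · simp

theorem IsTruncation.quadBound_sub (hT : IsTruncation r X T) (hX : X.IsSymm)
    (hG : IsThinSVD G U₀ σ) (hE : QuadBound (X - G) ε) (hε : 0 ≤ ε) :
    QuadBound (T - G) (2 * ε) := by
  obtain ⟨U, V, s, h, rfl⟩ := hT
  obtain ⟨-, hU⟩ := orthogonalGroup_transpose_mul h.left_orth
  obtain ⟨-, hV⟩ := orthogonalGroup_transpose_mul h.right_orth
  intro x
  set T := U * diagonal (fun i : Fin n => if (i : ℕ) < r then s i else 0) * Vᵀ with hT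
  have h1 : |x ⬝ᵥ X *ᵥ x - x ⬝ᵥ T *ᵥ x| ≤ ε * (x ⬝ᵥ x) := by
    rw [h.quadForm_eq, hT, dotProduct_conj_diagonal_mulVec, ← Finset.sum_sub_distrib]
    simp only [← sub_mul]
    refine sum_mul_mul_le_of_orth hU hV _ x (fun j => Or.inl ?_) hε
    split_ifs with hj
    · simpa using hε
    · rw [sub_zero, abs_of_nonneg (h.nonneg j)]
      exact h.singular_value_le hX hG hE (not_lt.mp hj)
  have h2 := hE x
  rw [Matrix.sub_mulVec, dotProduct_sub, abs_le] at *
  constructor <;> linarith [h1.1, h1.2, h2.1, h2.2]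

theorem rank_mul_transpose_sub_le (A B : Matrix (Fin n) (Fin r) ℝ) :
    (A * Aᵀ - B * Bᵀ).rank ≤ 2 * r := by
  have h : A * Aᵀ - B * Bᵀ = fromCols A B * fromRows Aᵀ (-Bᵀ) := by
    rw [fromCols_mul_fromRows, Matrix.mul_neg, sub_eq_add_neg]
  rw [h]
  refine (rank_mul_le_left _ _).trans ((rank_le_card_width _).trans ?_)
  rw [Fintype.card_sum, Fintype.card_fin]; omega

theorem isSymm_mul_transpose_sub (A B : Matrix (Fin n) (Fin r) ℝ) :
    (A * Aᵀ - B * Bᵀ).IsSymm := by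
  rw [Matrix.IsSymm, transpose_sub, transpose_mul, transpose_mul, transpose_transpose,
    transpose_transpose]

theorem trace_sq_mul_transpose_sub_le {A B : Matrix (Fin n) (Fin r) ℝ} {τ : ℝ}
    (h : QuadBound (A * Aᵀ - B * Bᵀ) τ) :
    trace ((A * Aᵀ - B * Bᵀ) * (A * Aᵀ - B * Bᵀ)) ≤ 2 * r * τ ^ 2 := by
  refine (trace_sq_le_of_quadBound (isSymm_mul_transpose_sub A B) h).trans ?_
  refine mul_le_mul_of_nonneg_right ?_ (sq_nonneg τ)
  exact_mod_cast rank_mul_transpose_sub_le A B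

end Truncation

/-! ### Orthogonal Procrustes problem and distance of factors -/

section Procrustes

variable {n r : ℕ}

theorem frobSq_eq_trace (A : Matrix (Fin n) (Fin r) ℝ) : frobSq A = trace (Aᵀ * A) := by
  simp only [frobSq, trace, diag_apply, Matrix.mul_apply, transpose_apply, ← pow_two]
  exact Finset.sum_comm

theorem frobSq_sub_mul (P Q : Matrix (Fin n) (Fin r) ℝ) {φ : Matrix (Fin r) (Fin r) ℝ}
    (hφ : φ * φᵀ = 1) :
    frobSq (P - Q * φ) = trace (Pᵀ * P) + trace (Qᵀ * Q) - 2 * trace (φᵀ * (Qᵀ * P)) := by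
  have e1 : trace (Pᵀ * (Q * φ)) = trace (φᵀ * (Qᵀ * P)) := by
    rw [← trace_transpose]
    simp only [transpose_mul, transpose_transpose, Matrix.mul_assoc]
  have e2 : trace (φᵀ * Qᵀ * (Q * φ)) = trace (Qᵀ * Q) := by
    rw [Matrix.mul_assoc, trace_mul_comm]
    calc _ = trace (Qᵀ * Q * (φ * φᵀ)) := by simp only [Matrix.mul_assoc]
      _ = _ := by rw [hφ, Matrix.mul_one]
  rw [frobSq_eq_trace, transpose_sub, transpose_mul, Matrix.sub_mul, Matrix.mul_sub,
    Matrix.mul_sub, trace_sub, trace_sub, trace_sub, e1, e2, Matrix.mul_assoc]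
  ring

theorem isCompact_orthogonalGroup :
    IsCompact (Matrix.orthogonalGroup (Fin r) ℝ : Set (Matrix (Fin r) (Fin r) ℝ)) := by
  have h1 : IsCompact (Set.pi Set.univ fun _ : Fin r => Set.pi Set.univ fun _ : Fin r =>
      Set.Icc (-1 : ℝ) 1) :=
    isCompact_univ_pi fun _ => isCompact_univ_pi fun _ => isCompact_Icc
  refine IsCompact.of_isClosed_subset (t := (_ : Set (Matrix (Fin r) (Fin r) ℝ))) h1 ?_ ?_
  · have : (Matrix.orthogonalGroup (Fin r) ℝ : Set (Matrix (Fin r) (Fin r) ℝ)) =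
        {A | Aᵀ * A = 1} := by
      ext A
      exact ⟨fun h => (orthogonalGroup_transpose_mul h).1,
        fun h => mem_orthogonalGroup_of_transpose_mul h⟩
    rw [this]
    exact isClosed_eq (by fun_prop) continuous_const
  · intro A hA i _ j _
    have := entry_norm_bound_of_unitary hA i j
    rw [Real.norm_eq_abs, abs_le] at this
    exact this

theorem exists_isProcrustes (P Q : Matrix (Fin n) (Fin r) ℝ) : ∃ ψ, IsProcrustes P Q ψ := by
  have hc : Continuous fun φ : Matrix (Fin r) (Fin r) ℝ => frobSq (P - Q * φ) := by
    simp only [frobSq_eq_trace]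
    fun_prop
  obtain ⟨ψ, hψ, hmin⟩ := isCompact_orthogonalGroup.exists_isMinOn
    ⟨1, one_mem _⟩ hc.continuousOn
  exact ⟨ψ, hψ, fun φ hφ => hmin hφ⟩

theorem trace_vecMulVec_mul (u v : Fin r → ℝ) (N : Matrix (Fin r) (Fin r) ℝ) :
    trace (vecMulVec v u * N) = u ⬝ᵥ N *ᵥ v := by
  rw [vecMulVec_mul, trace_vecMulVec, dotProduct_mulVec, dotProduct_comm]

/-- The reflection in the hyperplane orthogonal to `v`. -/
noncomputable def reflection (v : Fin r → ℝ) : Matrix (Fin r) (Fin r) ℝ :=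
  1 - (2 / (v ⬝ᵥ v)) • vecMulVec v v

theorem reflection_transpose (v : Fin r → ℝ) : (reflection v)ᵀ = reflection v := by
  rw [reflection, transpose_sub, transpose_one, transpose_smul, transpose_vecMulVec]

theorem reflection_mul_self {v : Fin r → ℝ} (hv : v ⬝ᵥ v ≠ 0) :
    reflection v * reflection v = 1 := by
  have h : vecMulVec v v * vecMulVec v v = (v ⬝ᵥ v) • vecMulVec v v := by
    rw [vecMulVec_mul_vecMulVec, vecMulVec_smul]
  rw [reflection, Matrix.sub_mul, Matrix.mul_sub, Matrix.mul_sub, smul_mul_smul_comm, h, smul_smul]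
  simp only [Matrix.one_mul, Matrix.mul_one]
  have : 2 / (v ⬝ᵥ v) * (2 / (v ⬝ᵥ v)) * (v ⬝ᵥ v) = 2 / (v ⬝ᵥ v) + 2 / (v ⬝ᵥ v) := by
    field_simp; ring
  rw [this, add_smul]; abel

theorem trace_reflection_mul (v : Fin r → ℝ) (N : Matrix (Fin r) (Fin r) ℝ) :
    trace (reflection v * N) = trace N - 2 / (v ⬝ᵥ v) * (v ⬝ᵥ N *ᵥ v) := by
  rw [reflection, Matrix.sub_mul, Matrix.one_mul, Matrix.smul_mul, trace_sub, trace_smul,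
    trace_vecMulVec_mul, smul_eq_mul]

variable {N : Matrix (Fin r) (Fin r) ℝ}

/-- Test maximality against the reflection along `v`. -/
theorem quadForm_nonneg_of_trace_max (h : ∀ R, Rᵀ * R = 1 → trace (Rᵀ * N) ≤ trace N)
    (v : Fin r → ℝ) : 0 ≤ v ⬝ᵥ N *ᵥ v := by
  have h0 : 0 ≤ v ⬝ᵥ v := Finset.sum_nonneg fun i _ => mul_self_nonneg _
  rcases h0.eq_or_lt with hv | hv
  · rw [dotProduct_self_eq_zero.mp hv.symm]; simp
  · have h1 := h (reflection v) (by rw [reflection_transpose, reflection_mul_self hv.ne'])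
    rw [reflection_transpose, trace_reflection_mul] at h1
    have h2 : 0 ≤ 2 / (v ⬝ᵥ v) * (v ⬝ᵥ N *ᵥ v) := by linarith
    exact nonneg_of_mul_nonneg_right h2 (by positivity)

/-- First-order optimality along rotations in coordinate planes: their effect on the trace is linear
in `N i j - N j i` up to second order, so this difference vanishes. -/
theorem isSymm_of_trace_max (h : ∀ R, Rᵀ * R = 1 → trace (Rᵀ * N) ≤ trace N) : N.IsSymm := by
  have key : ∀ i j, i ≠ j → ∀ τ : ℝ, τ * (N i j - N j i) ≤ τ ^ 2 * (N i i + N j j) := by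
    intro i j hij τ
    set u : Fin r → ℝ := Pi.single i 1 with hu
    set v : Fin r → ℝ := Pi.single i 1 + Pi.single j τ with hv
    have huu : u ⬝ᵥ u = 1 := by simp [hu]
    have hvv : v ⬝ᵥ v = 1 + τ ^ 2 := by
      simp [hv, hij, hij.symm, pow_two]
    have huv : v ⬝ᵥ u = 1 := by simp [hu, hv, hij]
    have hvu : u ⬝ᵥ v = 1 := by rw [dotProduct_comm, huv]
    have hpos : 0 < 1 + τ ^ 2 := by positivity
    -- Two reflections compose to a rotation of the `(i, j)` plane by twice the angle between `u`
    -- and `v`; `τ` is the tangent of that angle.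
    have h1 := h (reflection u * reflection v) (by
      rw [transpose_mul, reflection_transpose, reflection_transpose, Matrix.mul_assoc,
        ← Matrix.mul_assoc (reflection u), reflection_mul_self (by rw [huu]; norm_num),
        Matrix.one_mul, reflection_mul_self (by rw [hvv]; exact hpos.ne')])
    rw [transpose_mul, reflection_transpose, reflection_transpose, Matrix.mul_assoc,
      trace_reflection_mul, trace_reflection_mul] at h1
    have e1 : u ⬝ᵥ N *ᵥ u = N i i := by simp [hu]
    have e2 : v ⬝ᵥ N *ᵥ v = N i i + τ * (N i j + N j i) + τ ^ 2 * N j j := by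
      simp [hv, mulVec_add, mulVec_single]; ring
    have e3 : u ⬝ᵥ N *ᵥ v = N i i + τ * N i j := by
      simp [hu, hv, mulVec_add, mulVec_single]
    have e4 : v ⬝ᵥ (reflection u * N) *ᵥ v =
        v ⬝ᵥ N *ᵥ v - 2 * (N i i + τ * N i j) := by
      rw [reflection, Matrix.sub_mul, Matrix.one_mul, Matrix.smul_mul, Matrix.sub_mulVec,
        dotProduct_sub, Matrix.smul_mulVec, dotProduct_smul, ← mulVec_mulVec,
        vecMulVec_mulVec, huu, e3]
      simp [huv]
    rw [e4, huu, e1, e2, hvv] at h1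
    have h2 : 0 ≤ 2 / 1 * N i i + 2 / (1 + τ ^ 2) *
      (N i i + τ * (N i j + N j i) + τ ^ 2 * N j j - 2 * (N i i + τ * N i j)) := by linarith
    have h3 := mul_nonneg hpos.le h2
    have h4 : (1 + τ ^ 2) * (2 / 1 * N i i + 2 / (1 + τ ^ 2) *
      (N i i + τ * (N i j + N j i) + τ ^ 2 * N j j - 2 * (N i i + τ * N i j))) =
        2 * (τ ^ 2 * (N i i + N j j) - τ * (N i j - N j i)) := by
      field_simp; ring
    linarith
  have hdiag : ∀ i, 0 ≤ N i i := by
    intro i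
    have := quadForm_nonneg_of_trace_max h (Pi.single i 1)
    simpa using this
  have hle : ∀ i j, N i j ≤ N j i := by
    intro i j
    rcases eq_or_ne i j with rfl | hij
    · rfl
    by_contra! hlt
    set a := N i j - N j i with ha
    have ha0 : 0 < a := sub_pos.mpr hlt
    -- The added one makes `b` positive and the comparison at `τ = a / b` strict.
    set b := N i i + N j j + 1 with hb
    have hb0 : 0 < b := by have := hdiag i; have := hdiag j; linarith
    have h1 := key i j hij (a / b)
    have h2 : (a / b) ^ 2 * (N i i + N j j) < (a / b) ^ 2 * b := by
      have : 0 < (a / b) ^ 2 := by positivity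
      exact mul_lt_mul_of_pos_left (by linarith) this
    have h3 : (a / b) ^ 2 * b = a / b * a := by field_simp
    linarith
  ext i j
  rw [transpose_apply]
  exact le_antisymm (hle j i) (hle i j)

theorem IsProcrustes.trace_le {P Q : Matrix (Fin n) (Fin r) ℝ} {ψ : Matrix (Fin r) (Fin r) ℝ}
    (h : IsProcrustes P Q ψ) (R : Matrix (Fin r) (Fin r) ℝ) (hR : Rᵀ * R = 1) :
    trace (Rᵀ * ((Q * ψ)ᵀ * P)) ≤ trace ((Q * ψ)ᵀ * P) := by
  have hψ := orthogonalGroup_transpose_mul h.1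
  have hψR := mul_mem h.1 (mem_orthogonalGroup_of_transpose_mul hR)
  have h1 := h.2 _ hψR
  rw [frobSq_sub_mul _ _ hψ.2, frobSq_sub_mul _ _ (orthogonalGroup_transpose_mul hψR).2] at h1
  rw [transpose_mul ψ R] at h1
  rw [transpose_mul, Matrix.mul_assoc ψᵀ, ← Matrix.mul_assoc Rᵀ]
  linarith

/-- If `AᵀB` is symmetric positive semidefinite and `B` is well conditioned, then the distance of
`A` to `B` is controlled by the distance of the Gram matrices `AAᵀ` and `BBᵀ`. -/
theorem mul_frobSq_sub_le {A B : Matrix (Fin n) (Fin r) ℝ} {c : ℝ} (hs : (Bᵀ * A).IsSymm)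
    (hp : ∀ x, 0 ≤ x ⬝ᵥ (Bᵀ * A) *ᵥ x) (hB : ∀ x, c * (x ⬝ᵥ x) ≤ x ⬝ᵥ (Bᵀ * B) *ᵥ x) :
    c * frobSq (A - B) ≤ 2 * trace ((A * Aᵀ - B * Bᵀ) * (A * Aᵀ - B * Bᵀ)) := by
  set N := Bᵀ * A with hN
  have hN' : Aᵀ * B = N := by
    rw [← hs.eq, hN, transpose_mul, transpose_transpose]
  set a := Aᵀ * A with ha
  set b := Bᵀ * B with hb
  have haa : aᵀ = a := by rw [ha, transpose_mul, transpose_transpose]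
  have hbb : bᵀ = b := by rw [hb, transpose_mul, transpose_transpose]
  have e1 : trace ((A * Aᵀ - B * Bᵀ) * (A * Aᵀ - B * Bᵀ)) =
      trace (a * a) - 2 * trace (N * N) + trace (b * b) := by
    have f : ∀ C D : Matrix (Fin n) (Fin r) ℝ,
        trace (C * Cᵀ * (D * Dᵀ)) = trace ((Dᵀ * C) * (Cᵀ * D)) := by
      intro C D
      calc _ = trace (C * Cᵀ * D * Dᵀ) := by simp only [Matrix.mul_assoc]
        _ = _ := by rw [trace_mul_comm]; simp only [Matrix.mul_assoc]
    rw [Matrix.sub_mul, Matrix.mul_sub, Matrix.mul_sub, trace_sub, trace_sub, trace_sub,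
      f, f, f, f, hN', ← hN, ← ha, ← hb]
    ring
  have e2 : (A - B)ᵀ * (A - B) = a + b - (N + N) := by
    rw [transpose_sub, Matrix.sub_mul, Matrix.mul_sub, Matrix.mul_sub, hN', ← hN, ← ha, ← hb]
    abel
  -- Twice the trace in `e1` exceeds this one by `tr (a - b)²`. The weight `a + b + 2N` dominates
  -- `b`, hence `c`, because `a` and `N` are positive semidefinite.
  have e3 : trace ((A - B) * (a + b + (N + N)) * (A - B)ᵀ) =
      trace (a * a) + 2 * trace (a * b) + trace (b * b) - 4 * trace (N * N) := by
    rw [Matrix.mul_assoc, trace_mul_comm, Matrix.mul_assoc, e2]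
    have : (a + b + (N + N)) * (a + b - (N + N)) = a * a + a * b + b * a + b * b
        - (N * N + N * N + N * N + N * N) + ((N * a + N * a) - (a * N + a * N))
        + ((N * b + N * b) - (b * N + b * N)) := by noncomm_ring
    rw [this]
    simp only [trace_add, trace_sub]
    rw [trace_mul_comm b a, trace_mul_comm N a, trace_mul_comm N b]
    ring
  have e4 : 0 ≤ trace (a * a) - 2 * trace (a * b) + trace (b * b) := by
    have h1 : trace ((a - b)ᵀ * (a - b)) = trace (a * a) - 2 * trace (a * b) + trace (b * b) := by
      rw [transpose_sub, haa, hbb, Matrix.sub_mul, Matrix.mul_sub, Matrix.mul_sub, trace_sub,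
        trace_sub, trace_sub, trace_mul_comm b a]
      ring
    rw [← h1, ← frobSq_eq_trace]
    exact Finset.sum_nonneg fun i _ => Finset.sum_nonneg fun k _ => sq_nonneg _
  have e5 : c * frobSq (A - B) ≤ trace ((A - B) * (a + b + (N + N)) * (A - B)ᵀ) := by
    rw [frobSq, Finset.mul_sum, trace]
    refine Finset.sum_le_sum fun i _ => ?_
    have h1 : ((A - B) * (a + b + (N + N)) * (A - B)ᵀ).diag i =
        (A - B) i ⬝ᵥ (a + b + (N + N)) *ᵥ (A - B) i := by
      rw [diag_apply, Matrix.mul_assoc, Matrix.mul_apply, dotProduct]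
      refine Finset.sum_congr rfl fun k _ => ?_
      rw [Matrix.mul_apply]
      rfl
    rw [h1]
    set x := (A - B) i
    have h2 : ∑ k, (A - B) i k ^ 2 = x ⬝ᵥ x := by
      simp only [dotProduct, ← pow_two]; rfl
    have h3 : 0 ≤ x ⬝ᵥ a *ᵥ x := by
      rw [ha, ← mulVec_mulVec, dotProduct_mulVec, vecMul_transpose]
      exact Finset.sum_nonneg fun i _ => mul_self_nonneg _
    rw [h2, add_mulVec, add_mulVec, add_mulVec, dotProduct_add, dotProduct_add, dotProduct_add]
    linarith [hp x, hB x]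
  linarith

/-- `W = UᵀQ` is square with `WWᵀ = diag σ`, so also `Wᵀ diag(σ)⁻¹ W = 1`. Thus `c|x|² ≤ |Wx|²`, and
`|Wx| ≤ |Qx|` because `U` has orthonormal columns. -/
theorem IsThinSVD.mul_le_gram {Q : Matrix (Fin n) (Fin r) ℝ} {U : Matrix (Fin n) (Fin r) ℝ}
    {σ : Fin r → ℝ} (h : IsThinSVD (Q * Qᵀ) U σ) {c : ℝ} (hσ : ∀ i, c ≤ σ i)
    (x : Fin r → ℝ) : c * (x ⬝ᵥ x) ≤ x ⬝ᵥ (Qᵀ * Q) *ᵥ x := by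
  set W := Uᵀ * Q with hW
  have h1 : W * Wᵀ = diagonal σ := by
    rw [hW, transpose_mul, transpose_transpose]
    calc Uᵀ * Q * (Qᵀ * U) = Uᵀ * (Q * Qᵀ) * U := by simp only [Matrix.mul_assoc]
      _ = (Uᵀ * U) * diagonal σ * (Uᵀ * U) := by rw [h.eq]; simp only [Matrix.mul_assoc]
      _ = _ := by rw [h.orth, Matrix.one_mul, Matrix.mul_one]
  have h2 : W * (Wᵀ * diagonal fun i => (σ i)⁻¹) = 1 := by
    rw [← Matrix.mul_assoc, h1, diagonal_mul_diagonal, ← diagonal_one]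
    congr 1; funext i; exact mul_inv_cancel₀ (h.pos i).ne'
  have h3 : Wᵀ * (diagonal fun i => (σ i)⁻¹) * W = 1 := mul_eq_one_comm.mp h2
  have h4 : x ⬝ᵥ x = ∑ i, (σ i)⁻¹ * ((W *ᵥ x) i * (W *ᵥ x) i) := by
    have := dotProduct_conj_diagonal_mulVec Wᵀ Wᵀ (fun i => (σ i)⁻¹) x
    rw [transpose_transpose, h3, one_mulVec] at this
    exact this
  have h5 : c * (x ⬝ᵥ x) ≤ (W *ᵥ x) ⬝ᵥ (W *ᵥ x) := by
    rw [h4, Finset.mul_sum]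
    refine Finset.sum_le_sum fun i _ => ?_
    rw [← mul_assoc]
    refine mul_le_of_le_one_left (mul_self_nonneg _) ?_
    rw [← div_eq_mul_inv]
    exact (div_le_one (h.pos i)).mpr (hσ i)
  set y := Q *ᵥ x with hy
  have h6 : (W *ᵥ x) ⬝ᵥ (W *ᵥ x) ≤ y ⬝ᵥ y := by
    have e : W *ᵥ x = Uᵀ *ᵥ y := by rw [hW, hy, mulVec_mulVec]
    rw [e]
    set z := Uᵀ *ᵥ y with hz
    have f1 : y ⬝ᵥ U *ᵥ z = z ⬝ᵥ z := by
      rw [dotProduct_mulVec, ← mulVec_transpose]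
    have f2 : U *ᵥ z ⬝ᵥ U *ᵥ z = z ⬝ᵥ z := by
      rw [dotProduct_mulVec, ← mulVec_transpose, mulVec_mulVec, h.orth, one_mulVec]
    have f3 : 0 ≤ (y - U *ᵥ z) ⬝ᵥ (y - U *ᵥ z) :=
      Finset.sum_nonneg fun i _ => mul_self_nonneg _
    rw [sub_dotProduct, dotProduct_sub, dotProduct_sub, dotProduct_comm (U *ᵥ z) y, f1, f2] at f3
    linarith
  have h7 : x ⬝ᵥ (Qᵀ * Q) *ᵥ x = y ⬝ᵥ y := by
    rw [← mulVec_mulVec, dotProduct_mulVec, vecMul_transpose]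
  rw [h7]
  exact h5.trans h6

theorem IsProcrustes.mul_frobSq_le {P Q U : Matrix (Fin n) (Fin r) ℝ} {σ : Fin r → ℝ}
    {ψ : Matrix (Fin r) (Fin r) ℝ} (h : IsProcrustes P Q ψ) (hQ : IsThinSVD (Q * Qᵀ) U σ)
    {c : ℝ} (hσ : ∀ i, c ≤ σ i) :
    c * frobSq (P - Q * ψ) ≤ 2 * trace ((P * Pᵀ - Q * Qᵀ) * (P * Pᵀ - Q * Qᵀ)) := by
  have hψ := orthogonalGroup_transpose_mul h.1
  have e : Q * ψ * (Q * ψ)ᵀ = Q * Qᵀ := by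
    rw [transpose_mul, Matrix.mul_assoc, ← Matrix.mul_assoc ψ, hψ.2, Matrix.one_mul]
  rw [← e]
  refine mul_frobSq_sub_le (isSymm_of_trace_max h.trace_le)
    (quadForm_nonneg_of_trace_max h.trace_le) fun x => ?_
  have h1 := hQ.mul_le_gram hσ (ψ *ᵥ x)
  have h2 : ψ *ᵥ x ⬝ᵥ ψ *ᵥ x = x ⬝ᵥ x := by
    rw [dotProduct_mulVec, ← mulVec_transpose, mulVec_mulVec, hψ.1, one_mulVec]
  have h3 : ψ *ᵥ x ⬝ᵥ (Qᵀ * Q) *ᵥ (ψ *ᵥ x) = x ⬝ᵥ ((Q * ψ)ᵀ * (Q * ψ)) *ᵥ x := by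
    rw [dotProduct_comm, dotProduct_mulVec, ← mulVec_transpose, mulVec_mulVec, mulVec_mulVec,
      dotProduct_comm, transpose_mul]
    simp only [Matrix.mul_assoc]
  rwa [h2, h3] at h1

end Procrustes

/-! ### Row norms and trimming -/

section Trim

variable {n r : ℕ}

theorem rowNorm_sq (A : Matrix (Fin n) (Fin r) ℝ) (i : Fin n) :
    rowNorm A i ^ 2 = ∑ k, A i k ^ 2 :=
  Real.sq_sqrt (Finset.sum_nonneg fun _ _ => sq_nonneg _)

theorem rowNorm_nonneg (A : Matrix (Fin n) (Fin r) ℝ) (i : Fin n) : 0 ≤ rowNorm A i :=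
  Real.sqrt_nonneg _

theorem rowNorm_le_normTwoInf (A : Matrix (Fin n) (Fin r) ℝ) (i : Fin n) :
    rowNorm A i ≤ normTwoInf A :=
  le_ciSup (Set.finite_range _).bddAbove i

theorem rowNorm_mul_orthogonal (A : Matrix (Fin n) (Fin r) ℝ) {ψ : Matrix (Fin r) (Fin r) ℝ}
    (hψ : ψ * ψᵀ = 1) (i : Fin n) : rowNorm (A * ψ) i = rowNorm A i := by
  have h : ∀ B : Matrix (Fin n) (Fin r) ℝ, ∑ k, B i k ^ 2 = (B * Bᵀ) i i := by
    intro B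
    rw [Matrix.mul_apply]
    exact Finset.sum_congr rfl fun k _ => by rw [transpose_apply, pow_two]
  rw [rowNorm, rowNorm, h, h, transpose_mul, Matrix.mul_assoc, ← Matrix.mul_assoc ψ, hψ,
    Matrix.one_mul]

theorem rowNorm_trim_le {t : ℝ} (ht : 0 ≤ t) (P : Matrix (Fin n) (Fin r) ℝ) (i : Fin n) :
    rowNorm (trim t P) i ≤ t := by
  by_cases h : rowNorm P i ≤ t
  · have : rowNorm (trim t P) i = rowNorm P i := by
      unfold rowNorm; simp only [trim, of_apply, if_pos h]
    rwa [this]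
  · have hpos : 0 < rowNorm P i := ht.trans_lt (not_le.mp h)
    refine Real.sqrt_le_iff.mpr ⟨ht, le_of_eq ?_⟩
    have e : ∀ k, trim t P i k ^ 2 = P i k ^ 2 * (t ^ 2 / rowNorm P i ^ 2) := by
      intro k
      simp only [trim, of_apply, if_neg h]
      field_simp
    simp only [e]
    rw [← Finset.sum_mul, ← rowNorm_sq]
    field_simp

theorem sum_row_mul_le (A B : Matrix (Fin n) (Fin r) ℝ) (i : Fin n) :
    ∑ k, A i k * B i k ≤ rowNorm A i * rowNorm B i :=
  Real.sum_mul_le_sqrt_mul_sqrt _ _ _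

/-- Trimming at level `t` does not increase the distance to a matrix with rows of norm at most
`t`. -/
theorem frobSq_trim_sub_le {t : ℝ} (ht : 0 ≤ t) (P B : Matrix (Fin n) (Fin r) ℝ)
    (hB : ∀ i, rowNorm B i ≤ t) : frobSq (trim t P - B) ≤ frobSq (P - B) := by
  refine Finset.sum_le_sum fun i _ => ?_
  by_cases h : rowNorm P i ≤ t
  · refine le_of_eq (Finset.sum_congr rfl fun k _ => ?_)
    simp [trim, h]
  · have hlt := not_le.mp h
    have hpos : 0 < rowNorm P i := ht.trans_lt hlt
    set ρ := rowNorm P i with hρ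
    have e : ∀ A : Matrix (Fin n) (Fin r) ℝ, ∑ k, (A - B) i k ^ 2 =
        ∑ k, A i k ^ 2 - 2 * ∑ k, A i k * B i k + ∑ k, B i k ^ 2 := by
      intro A
      rw [Finset.mul_sum, ← Finset.sum_sub_distrib, ← Finset.sum_add_distrib]
      exact Finset.sum_congr rfl fun k _ => by rw [Matrix.sub_apply]; ring
    have e1 : ∑ k, trim t P i k ^ 2 = t ^ 2 := by
      have : ∀ k, trim t P i k ^ 2 = P i k ^ 2 * (t ^ 2 / ρ ^ 2) := by
        intro k
        simp only [trim, of_apply, if_neg h, ← hρ]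
        field_simp
      simp only [this]
      rw [← Finset.sum_mul, ← rowNorm_sq, ← hρ]
      field_simp
    have e2 : ∑ k, trim t P i k * B i k = t / ρ * ∑ k, P i k * B i k := by
      rw [Finset.mul_sum]
      refine Finset.sum_congr rfl fun k _ => ?_
      simp only [trim, of_apply, if_neg h, ← hρ]
      ring
    rw [e, e, e1, e2, ← rowNorm_sq P, ← hρ]
    -- With this bound the squared distance of the row drops by at least `(ρ - t)²`.
    have h1 : ∑ k, P i k * B i k ≤ ρ * t :=
      (sum_row_mul_le P B i).trans (mul_le_mul_of_nonneg_left (hB i) hpos.le)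
    have h2 : (1 - t / ρ) * ∑ k, P i k * B i k ≤ (1 - t / ρ) * (ρ * t) :=
      mul_le_mul_of_nonneg_left h1 (sub_nonneg.mpr ((div_le_one hpos).mpr hlt.le))
    have h3 : (1 - t / ρ) * (ρ * t) = ρ * t - t ^ 2 := by field_simp
    nlinarith [sq_nonneg (ρ - t)]

theorem normTwoInf_sub_le {A B : Matrix (Fin n) (Fin r) ℝ} {t : ℝ} (ht : 0 ≤ t)
    (hA : ∀ i, rowNorm A i ≤ t) (hB : ∀ i, rowNorm B i ≤ t) : normTwoInf (A - B) ≤ 2 * t := by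
  refine Real.iSup_le (fun i => ?_) (by linarith)
  refine Real.sqrt_le_iff.mpr ⟨by linarith, ?_⟩
  have h1 : ∑ k, (A - B) i k ^ 2 ≤ 2 * rowNorm A i ^ 2 + 2 * rowNorm B i ^ 2 := by
    rw [rowNorm_sq, rowNorm_sq, Finset.mul_sum, Finset.mul_sum, ← Finset.sum_add_distrib]
    refine Finset.sum_le_sum fun k _ => ?_
    rw [Matrix.sub_apply]
    nlinarith [sq_nonneg (A i k + B i k)]
  have h2 := pow_le_pow_left₀ (rowNorm_nonneg A i) (hA i) 2
  have h3 := pow_le_pow_left₀ (rowNorm_nonneg B i) (hB i) 2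
  linarith

theorem abs_edm_le {P : Matrix (Fin n) (Fin r) ℝ} {t : ℝ} (hP : ∀ i, rowNorm P i ≤ t)
    (i j : Fin n) : |edm P i j| ≤ 4 * t ^ 2 := by
  have h1 : ∑ k, (P i k - P j k) ^ 2 ≤ 2 * rowNorm P i ^ 2 + 2 * rowNorm P j ^ 2 := by
    rw [rowNorm_sq, rowNorm_sq, Finset.mul_sum, Finset.mul_sum, ← Finset.sum_add_distrib]
    refine Finset.sum_le_sum fun k _ => ?_
    nlinarith [sq_nonneg (P i k + P j k)]
  have h0 : 0 ≤ ∑ k, (P i k - P j k) ^ 2 := Finset.sum_nonneg fun k _ => sq_nonneg _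
  have h2 := pow_le_pow_left₀ (rowNorm_nonneg P i) (hP i) 2
  have h3 := pow_le_pow_left₀ (rowNorm_nonneg P j) (hP j) 2
  rw [edm, of_apply, abs_of_nonneg h0]
  linarith

end Trim

/-! ### Centering and classical multidimensional scaling -/

section Centering

variable {n r : ℕ}

theorem centering_eq (n : ℕ) :
    centering n = 1 - (1 / (n : ℝ)) • vecMulVec (1 : Fin n → ℝ) 1 := by
  rw [centering]
  congr 2
  ext i j
  simp [vecMulVec_apply]

theorem centering_transpose (n : ℕ) : (centering n)ᵀ = centering n := by
  rw [centering_eq, transpose_sub, transpose_one, transpose_smul, transpose_vecMulVec]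

theorem centering_mulVec_one (hn : n ≠ 0) : centering n *ᵥ 1 = 0 := by
  have h : (1 : Fin n → ℝ) ⬝ᵥ 1 = n := by simp [dotProduct]
  have hn' : (n : ℝ) ≠ 0 := Nat.cast_ne_zero.mpr hn
  rw [centering_eq, Matrix.sub_mulVec, one_mulVec, Matrix.smul_mulVec, vecMulVec_mulVec, h]
  funext i
  simp [hn']

theorem centering_mul_self (hn : n ≠ 0) : centering n * centering n = centering n := by
  conv_lhs => rhs; rw [centering_eq]
  rw [Matrix.mul_sub, Matrix.mul_one, Matrix.mul_smul, mul_vecMulVec, centering_mulVec_one hn,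
    zero_vecMulVec, smul_zero, sub_zero]

theorem centering_mul_of_centered {P : Matrix (Fin n) (Fin r) ℝ} (hP : ∀ k, ∑ i, P i k = 0) :
    centering n * P = P := by
  have h : (1 : Fin n → ℝ) ᵥ* P = 0 := by
    funext k
    simp [vecMul, dotProduct, hP k]
  have h0 : vecMulVec (1 : Fin n → ℝ) (0 : Fin r → ℝ) = 0 := by
    ext i k
    simp [vecMulVec_apply]
  rw [centering_eq, Matrix.sub_mul, Matrix.one_mul, Matrix.smul_mul, vecMulVec_mul, h, h0,
    smul_zero, sub_zero]

theorem QuadBound.centering_conj {Y : Matrix (Fin n) (Fin n) ℝ} {τ : ℝ} (hn : n ≠ 0)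
    (hτ : 0 ≤ τ) (h : QuadBound Y τ) : QuadBound (centering n * Y * centering n) τ := by
  intro x
  set y := centering n *ᵥ x with hy
  have h1 : x ⬝ᵥ (centering n * Y * centering n) *ᵥ x = y ⬝ᵥ Y *ᵥ y := by
    rw [← mulVec_mulVec, ← mulVec_mulVec, dotProduct_mulVec, ← mulVec_transpose,
      centering_transpose]
  have h2 : x ⬝ᵥ y = y ⬝ᵥ y := by
    conv_rhs => rw [hy, dotProduct_mulVec, ← mulVec_transpose, centering_transpose, mulVec_mulVec,
      centering_mul_self hn]
    exact dotProduct_comm _ _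
  have h3 : y ⬝ᵥ y ≤ x ⬝ᵥ x := by
    have : 0 ≤ (x - y) ⬝ᵥ (x - y) := Finset.sum_nonneg fun i _ => mul_self_nonneg _
    rw [sub_dotProduct, dotProduct_sub, dotProduct_sub, dotProduct_comm y x, h2] at this
    linarith
  rw [h1]
  exact (h y).trans (mul_le_mul_of_nonneg_left h3 hτ)

theorem centering_mul_edm_mul_centering (hn : n ≠ 0) {P : Matrix (Fin n) (Fin r) ℝ}
    (hP : ∀ k, ∑ i, P i k = 0) :
    centering n * edm P * centering n = (-2 : ℝ) • (P * Pᵀ) := by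
  set v : Fin n → ℝ := fun i => ∑ k, P i k ^ 2 with hv
  have h1 : edm P = vecMulVec v 1 + vecMulVec 1 v + (-2 : ℝ) • (P * Pᵀ) := by
    ext i j
    simp only [edm, of_apply, Matrix.add_apply, vecMulVec_apply, Pi.one_apply, hv, mul_one,
      one_mul, Matrix.smul_apply, Matrix.mul_apply, transpose_apply, smul_eq_mul, Finset.mul_sum,
      ← Finset.sum_add_distrib]
    exact Finset.sum_congr rfl fun k _ => by ring
  have h2 : Pᵀ * centering n = Pᵀ := by
    have := congrArg transpose (centering_mul_of_centered hP)
    rwa [transpose_mul, centering_transpose] at this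
  have h3 : (1 : Fin n → ℝ) ᵥ* centering n = 0 := by
    rw [← mulVec_transpose, centering_transpose, centering_mulVec_one hn]
  rw [h1, Matrix.mul_add, Matrix.mul_add, Matrix.add_mul, Matrix.add_mul, mul_vecMulVec,
    mul_vecMulVec, centering_mulVec_one hn, zero_vecMulVec, Matrix.zero_mul, vecMulVec_mul, h3,
    vecMulVec_zero, Matrix.mul_smul, Matrix.smul_mul, ← Matrix.mul_assoc,
    centering_mul_of_centered hP, Matrix.mul_assoc, h2]
  simp

theorem sum_smul_pairMatrix {D : Matrix (Fin n) (Fin n) ℝ} (hD : D.IsSymm)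
    (hd : ∀ i, D i i = 0) : ∑ a : Pairs n, D a.1.1 a.1.2 • pairMatrix a = D := by
  have hlt : ∀ i j : Fin n, i < j → (∑ a : Pairs n, D a.1.1 a.1.2 • pairMatrix a) i j = D i j := by
    intro i j hij
    rw [Matrix.sum_apply, Finset.sum_eq_single ⟨(i, j), hij⟩]
    · simp [pairMatrix, hij.ne']
    · rintro ⟨⟨a, b⟩, hab⟩ - hne
      have h1 : ¬(a = i ∧ b = j) := fun h => hne (Subtype.ext (Prod.ext h.1 h.2))
      have h2 : ¬(b = i ∧ a = j) := by
        rintro ⟨rfl, rfl⟩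
        exact lt_asymm hij hab
      simp [pairMatrix, h1, h2]
    · simp
  have hs : (∑ a : Pairs n, D a.1.1 a.1.2 • pairMatrix a).IsSymm := by
    rw [Matrix.IsSymm, transpose_sum]
    exact Finset.sum_congr rfl fun a _ => by rw [transpose_smul, (pairMatrix_isSymm a).eq]
  ext i j
  rcases lt_trichotomy i j with h | rfl | h
  · exact hlt i j h
  · rw [hd, Matrix.sum_apply]
    refine Finset.sum_eq_zero fun a _ => ?_
    have h1 : ¬(a.1.1 = i ∧ a.1.2 = i) := fun h => a.2.ne (h.1.trans h.2.symm)
    have h2 : ¬(a.1.2 = i ∧ a.1.1 = i) := fun h => a.2.ne (h.2.trans h.1.symm)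
    simp [pairMatrix, h1, h2]
  · rw [← hs.apply, hlt j i h, hD.apply]

theorem noise_eq {D : Matrix (Fin n) (Fin n) ℝ} (hD : D.IsSymm) (hd : ∀ i, D i i = 0) (p : ℝ)
    (d : Pairs n → Bool) : noise p D d = (1 / p) • sample d D - D := by
  conv_rhs => rhs; rw [← sum_smul_pairMatrix hD hd]
  rw [noise, sample, Finset.smul_sum, ← Finset.sum_sub_distrib]
  refine Finset.sum_congr rfl fun a _ => ?_
  have h1 : Matrix.single a.1.1 a.1.2 (D a.1.1 a.1.2) + Matrix.single a.1.2 a.1.1 (D a.1.2 a.1.1) =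
      D a.1.1 a.1.2 • pairMatrix a := by
    rw [hD.apply a.1.1 a.1.2, pairMatrix, smul_add, smul_single, smul_single, smul_eq_mul, mul_one]
  rw [h1, noiseTerm, smul_smul, smul_smul, ← sub_smul, bitVal]
  congr 1
  ring

theorem edm_isSymm (P : Matrix (Fin n) (Fin r) ℝ) : (edm P).IsSymm := by
  ext i j
  simp only [edm, transpose_apply, of_apply]
  exact Finset.sum_congr rfl fun k _ => by ring

theorem edm_diag (P : Matrix (Fin n) (Fin r) ℝ) (i : Fin n) : edm P i i = 0 := by
  simp [edm]

theorem oneStepMDS_sub_gram (hn : n ≠ 0) {P : Matrix (Fin n) (Fin r) ℝ}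
    (hP : ∀ k, ∑ i, P i k = 0) (p : ℝ) (d : Pairs n → Bool) :
    oneStepMDS p d (edm P) - P * Pᵀ =
      (-(1 / 2) : ℝ) • (centering n * noise p (edm P) d * centering n) := by
  rw [noise_eq (edm_isSymm P) (edm_diag P), Matrix.mul_sub, Matrix.sub_mul,
    centering_mul_edm_mul_centering hn hP, oneStepMDS, Matrix.mul_smul, Matrix.smul_mul, smul_sub,
    smul_smul, smul_smul]
  congr 2
  · ring
  · norm_num

end Centering

/-! ### From small noise to the contraction region -/

section Deterministic

variable {n r : ℕ}

/-- If the sampling noise is small, then every rank-`r` truncation of the one-step MDS matrix has a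
factor, and each of its trimmed factors lies in the contraction region. -/
theorem trim_mem_region_of_quadBound {cI μ p : ℝ} (hcI : 4 < cI) (hr : 0 < r) (hrn : r ≤ n)
    (hμ : 0 ≤ μ) {Pstar U : Matrix (Fin n) (Fin r) ℝ} {σ : Fin r → ℝ}
    (hP : ∀ k, ∑ i, Pstar i k = 0) (hS : IsThinSVD (Pstar * Pstarᵀ) U σ)
    (hinc : normTwoInf Pstar ≤ Real.sqrt (μ * r * σ ⟨0, hr⟩ / n)) {d : Pairs n → Bool}
    (hY : QuadBound (noise p (edm Pstar) d)
      (σ ⟨r - 1, Nat.sub_lt hr Nat.one_pos⟩ / (7 * Real.sqrt r))) :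
    (∃ T, IsTruncation r (oneStepMDS p d (edm Pstar)) T) ∧
      ∀ T, IsTruncation r (oneStepMDS p d (edm Pstar)) T →
        (∃ Phat : Matrix (Fin n) (Fin r) ℝ, Phat * Phatᵀ = T) ∧
        ∀ Phat : Matrix (Fin n) (Fin r) ℝ, Phat * Phatᵀ = T →
          trim (Real.sqrt (μ * r * σ ⟨0, hr⟩ / n)) Phat ∈
            region Pstar cI (80 / 7) μ (σ ⟨0, hr⟩) (σ ⟨r - 1, Nat.sub_lt hr Nat.one_pos⟩) := by
  set σ₁ := σ ⟨0, hr⟩ with hσ₁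
  set σr := σ ⟨r - 1, Nat.sub_lt hr Nat.one_pos⟩ with hσr
  set t := Real.sqrt (μ * r * σ₁ / n) with ht
  have hn : n ≠ 0 := by omega
  have hσrpos : 0 < σr := hS.pos _
  have hσ₁pos : 0 < σ₁ := hS.pos _
  have hσ : ∀ i, σr ≤ σ i := fun i => hS.sorted (Fin.mk_le_mk.mpr (by have := i.2; omega))
  have hr1 : (1 : ℝ) ≤ r := by exact_mod_cast hr
  have hsr : 1 ≤ Real.sqrt r := Real.one_le_sqrt.mpr hr1
  have hsq : Real.sqrt r ^ 2 = r := Real.sq_sqrt (by linarith)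
  set X := oneStepMDS p d (edm Pstar) with hX
  -- Half of the noise level, because of the factor `-1/2` in `oneStepMDS_sub_gram`.
  set ε := σr / (14 * Real.sqrt r) with hε
  have hε0 : 0 ≤ ε := by positivity
  have hεσ : 2 * ε < σr := by
    rw [hε, mul_div_assoc', div_lt_iff₀ (by positivity)]
    nlinarith
  have hεr : r * ε ^ 2 = σr ^ 2 / 196 := by
    rw [hε, div_pow, mul_pow, hsq]; field_simp; norm_num
  have hsub := oneStepMDS_sub_gram hn hP p d
  have hE : QuadBound (X - Pstar * Pstarᵀ) ε := by
    intro x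
    have h1 := hY.centering_conj hn (div_nonneg hσrpos.le (by positivity)) x
    rw [hX, hsub, Matrix.smul_mulVec, dotProduct_smul, smul_eq_mul, abs_mul]
    have h2 : ε = 1 / 2 * (σr / (7 * Real.sqrt r)) := by rw [hε]; field_simp; norm_num
    rw [h2, mul_assoc (1 / 2 : ℝ)]
    have h3 : |(-(1 / 2) : ℝ)| = 1 / 2 := by rw [abs_neg]; norm_num
    rw [h3]
    exact mul_le_mul_of_nonneg_left h1 (by norm_num : (0 : ℝ) ≤ 1 / 2)
  have hXs : X.IsSymm := by
    have h1 : X = (-(1 / 2) : ℝ) • (centering n * noise p (edm Pstar) d * centering n) +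
        Pstar * Pstarᵀ := by rw [← hsub, hX]; abel
    rw [Matrix.IsSymm, h1, transpose_add, transpose_smul, transpose_mul, transpose_mul,
      transpose_mul, transpose_transpose, centering_transpose, (noise_isSymm p _ d).eq,
      Matrix.mul_assoc]
  refine ⟨?_, fun T hT => ⟨hT.exists_factor hrn hXs hS hE hσ hεσ, ?_⟩⟩
  · obtain ⟨V, W, s, h⟩ := exists_isSVD hXs
    exact ⟨_, V, W, s, h, rfl⟩
  rintro Phat rfl
  have ht0 : 0 ≤ t := Real.sqrt_nonneg _
  have hPrt : ∀ i, rowNorm Pstar i ≤ t := fun i => (rowNorm_le_normTwoInf Pstar i).trans hinc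
  obtain ⟨φ, hφ⟩ := exists_isProcrustes Phat Pstar
  obtain ⟨ψ, hψ⟩ := exists_isProcrustes (trim t Phat) Pstar
  have hrow : ∀ χ ∈ Matrix.orthogonalGroup (Fin r) ℝ, ∀ i, rowNorm (Pstar * χ) i ≤ t := by
    intro χ hχ i
    rw [rowNorm_mul_orthogonal _ (orthogonalGroup_transpose_mul hχ).2]
    exact hPrt i
  refine ⟨ψ, hψ, ?_, ?_⟩
  · refine (normTwoInf_sub_le ht0 (rowNorm_trim_le ht0 Phat) (hrow ψ hψ.1)).trans ?_
    have h4 : 2 * t = Real.sqrt (4 * (μ * r * σ₁ / n)) := by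
      rw [Real.sqrt_mul (by norm_num), ← ht]
      congr 1
      rw [show (4 : ℝ) = 2 ^ 2 by norm_num, Real.sqrt_sq (by norm_num)]
    rw [h4]
    refine Real.sqrt_le_sqrt ?_
    have h5 : 0 ≤ μ * r * σ₁ / n := by positivity
    calc 4 * (μ * r * σ₁ / n) ≤ cI * (μ * r * σ₁ / n) := by gcongr
      _ = _ := by ring
  -- The Procrustes solutions before and after trimming may differ: optimality of `ψ` replaces it by
  -- `φ`, and trimming is then compared with the fixed target `Pstar * φ`.
  · have h6 : frobSq (trim t Phat - Pstar * ψ) ≤ frobSq (Phat - Pstar * φ) :=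
      (hψ.2 φ hφ.1).trans (frobSq_trim_sub_le ht0 _ _ (hrow φ hφ.1))
    have h7 := hφ.mul_frobSq_le hS hσ
    have h8 := trace_sq_mul_transpose_sub_le (hT.quadBound_sub hXs hS hE hε0)
    -- The factor is `2 · 2r · (2ε)² = 16 r ε²`; the resulting `16/196` is below `7/80`.
    have h9 : σr * frobSq (Phat - Pstar * φ) ≤ σr * (16 / 196 * σr) := by
      nlinarith
    have h10 := le_of_mul_le_mul_left h9 hσrpos
    refine h6.trans (h10.trans ?_)
    rw [le_div_iff₀ (by norm_num)]
    nlinarith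

end Deterministic

/-! ### Passage to the probability space and Markov's inequality -/

section Law

variable {ι : Type*} [Fintype ι] [DecidableEq ι] {S : Type*} [MeasurableSpace S]
  {Pr : Measure S} [IsProbabilityMeasure Pr] {δ : ι → S → Bool} {p : ℝ}

/-- A union bound over the finitely many bit patterns in `B`, each of product probability by
independence. Only the upper bound is needed. -/
theorem measureReal_bernoulli_mem_le (hm : ∀ a, Measurable (δ a)) (hind : iIndepFun δ Pr)
    (hp : ∀ a, Pr.real {ω | δ a ω = true} = p) (B : Set (ι → Bool)) :
    Pr.real {ω | (fun a => δ a ω) ∈ B} ≤ prodExp (bernWeight p) (B.indicator 1) := by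
  classical
  have h0 : ∀ a b, Pr.real (δ a ⁻¹' {b}) = bernWeight p b := by
    intro a b
    cases b
    · have h1 : δ a ⁻¹' {false} = {ω | δ a ω = true}ᶜ := by ext ω; simp
      have h2 : MeasurableSet {ω | δ a ω = true} := hm a (MeasurableSet.singleton true)
      rw [h1, probReal_compl_eq_one_sub h2, hp]
      simp [bernWeight]
    · exact (hp a).trans (by simp [bernWeight])
  have h1 : ∀ d : ι → Bool, Pr.real (⋂ a, δ a ⁻¹' {d a}) = ∏ a, bernWeight p (d a) := by
    intro d
    have := hind.meas_iInter (s := fun a => δ a ⁻¹' {d a})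
      (fun a => ⟨{d a}, MeasurableSet.singleton _, rfl⟩)
    rw [measureReal_def, this, ENNReal.toReal_prod]
    exact Finset.prod_congr rfl fun a _ => h0 a (d a)
  have h2 : {ω | (fun a => δ a ω) ∈ B} ⊆
      ⋃ d ∈ Finset.univ.filter (· ∈ B), ⋂ a, δ a ⁻¹' {d a} := by
    intro ω hω
    simp only [Set.mem_iUnion]
    exact ⟨fun a => δ a ω, by simpa using hω, by simp⟩
  refine (measureReal_mono h2 (measure_ne_top _ _)).trans ((measureReal_biUnion_finset_le _ _).trans (le_of_eq ?_))
  rw [prodExp, Finset.sum_filter]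
  refine Finset.sum_congr rfl fun d _ => ?_
  rw [h1, Set.indicator_apply]
  split_ifs <;> simp

/-- Markov's inequality for the nonnegative trace; `hτK` makes each of the `q` factors of the moment
bound a gain of `e⁻¹`. -/
theorem measureReal_trace_noise_gt_le {n : ℕ} {p K τ : ℝ} {δ : Pairs n → S → Bool}
    (hm : ∀ a, Measurable (δ a)) (hind : iIndepFun δ Pr)
    (hδ : ∀ a, Pr.real {ω | δ a ω = true} = p) (hp : 0 < p) (hp1 : p ≤ 1)
    {D : Matrix (Fin n) (Fin n) ℝ} (hD : ∀ i j, |D i j| ≤ K) {q : ℕ} (hq : 0 < q)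
    (hqL : (q : ℝ) ≤ n * p) (hτ : 0 < τ)
    (hτK : 4 * q * Real.exp 6 * K ^ 2 * n / p ≤ Real.exp (-1) * τ ^ 2) :
    Pr.real {ω | ¬ trace (noise p D (fun a => δ a ω) ^ (2 * q)) ≤ τ ^ (2 * q)} ≤
      n * Real.exp (-q) := by
  have hw : ∀ b, 0 ≤ bernWeight p b := by
    intro b; unfold bernWeight; split_ifs <;> linarith
  have hτq : 0 < τ ^ (2 * q) := by positivity
  set B : Set (Pairs n → Bool) := {d | ¬ trace (noise p D d ^ (2 * q)) ≤ τ ^ (2 * q)} with hB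
  refine (measureReal_bernoulli_mem_le hm hind hδ B).trans ?_
  have h1 : prodExp (bernWeight p) (B.indicator 1) ≤
      prodExp (bernWeight p) fun d => (τ ^ (2 * q))⁻¹ * trace (noise p D d ^ (2 * q)) := by
    refine prodExp_mono hw fun d => ?_
    by_cases hd : d ∈ B
    · rw [Set.indicator_of_mem hd, Pi.one_apply, inv_mul_eq_div, one_le_div hτq]
      exact (not_le.mp hd).le
    · rw [Set.indicator_of_notMem hd]
      exact mul_nonneg (inv_nonneg.mpr hτq.le) (Finset.sum_nonneg fun i _ =>
        pow_even_diag_nonneg (noise_isSymm p D d) q i)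
  refine h1.trans ?_
  rw [prodExp_const_mul, inv_mul_le_iff₀ hτq]
  refine (prodExp_trace_noise_pow_le hp hp1 hD hq hqL).trans ?_
  have h2 : (4 * q * Real.exp 6 * K ^ 2 * n / p) ^ q ≤ (Real.exp (-1) * τ ^ 2) ^ q :=
    pow_le_pow_left₀ (by positivity) hτK q
  refine (mul_le_mul_of_nonneg_left h2 (Nat.cast_nonneg n)).trans (le_of_eq ?_)
  rw [mul_pow, ← Real.exp_nat_mul, ← pow_mul, mul_neg_one]
  ring

end Law

end EDMC

/-! ### Main theorem: choice of the constants and of the moment order -/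

theorem lemma2p1 (β cI : ℝ) (hβ : 2 < β) (hcI : 4 < cI) :
    ∃ C : ℝ, 0 < C ∧
      ∀ (n r : ℕ) (hr : 0 < r) (μ p : ℝ)
        (Pstar : Matrix (Fin n) (Fin r) ℝ)
        (U : Matrix (Fin n) (Fin r) ℝ) (σ : Fin r → ℝ) (σ₁ σr κ : ℝ)
        (S : Type*) (mS : MeasurableSpace S) (Pr : Measure S) (δ : EDMC.Pairs n → S → Bool),
        -- the ground truth: centered, of full column rank, incoherent
        (∀ k, ∑ i, Pstar i k = 0) →
        EDMC.IsThinSVD (Pstar * Pstar.transpose) U σ →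
        σ₁ = σ ⟨0, hr⟩ →
        σr = σ ⟨r - 1, Nat.sub_lt hr Nat.one_pos⟩ →
        κ = σ₁ / σr →
        1 ≤ μ → μ ≤ (n : ℝ) / r →
        EDMC.normTwoInf U ≤ Real.sqrt (μ * r / n) →
        EDMC.normTwoInf Pstar ≤ Real.sqrt (μ * r * σ₁ / n) →
        -- the symmetric Bernoulli sampling model
        IsProbabilityMeasure Pr →
        (∀ a, Measurable (δ a)) →
        iIndepFun δ Pr →
        (∀ a, Pr.real {ω | δ a ω = true} = p) →
        -- the sampling rate
        C * (μ ^ 2 * (r : ℝ) ^ 3 * κ ^ 2 * Real.log n / n) ≤ p →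
        1 - (n : ℝ) ^ (1 - β) ≤
          Pr.real {ω |
            (∃ T, EDMC.IsTruncation r
              (EDMC.oneStepMDS p (fun a => δ a ω) (EDMC.edm Pstar)) T) ∧
            ∀ T, EDMC.IsTruncation r
                (EDMC.oneStepMDS p (fun a => δ a ω) (EDMC.edm Pstar)) T →
              (∃ Phat : Matrix (Fin n) (Fin r) ℝ, Phat * Phat.transpose = T) ∧
              ∀ Phat : Matrix (Fin n) (Fin r) ℝ, Phat * Phat.transpose = T →
                EDMC.trim (Real.sqrt (μ * r * σ₁ / n)) Phat ∈
                  EDMC.region Pstar cI (80 / 7) μ σ₁ σr} := by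
  -- `3136 = 4 · 16 · 49`: the moment bound gives `4`, the squared entry bound `(4t²)²` gives `16`,
  -- and `τ²` gives `49`. `e⁷` joins `e⁶` from the degrees with `e` from Markov, and `β + 2` bounds
  -- `q / log n`.
  refine ⟨3136 * Real.exp 7 * (β + 2), by positivity, ?_⟩
  intro n r hr μ p Pstar U σ σ₁ σr κ S mS Pr δ hP hS hσ₁ hσr hκ hμ hμn _ hinc hPr hm hind hδ hC
  rcases Nat.lt_or_ge n 2 with hn2 | hn2
  · have hn0 : n ≠ 0 := by
      rintro rfl
      rw [Nat.cast_zero, zero_div] at hμn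
      linarith
    have hn1 : n = 1 := by omega
    subst hn1
    rw [Nat.cast_one, Real.one_rpow, sub_self]
    exact measureReal_nonneg
  subst hσ₁ hσr
  set σ₁ := σ ⟨0, hr⟩ with hσ₁
  set σr := σ ⟨r - 1, Nat.sub_lt hr Nat.one_pos⟩ with hσr
  have hσrpos : 0 < σr := hS.pos _
  have hσ₁pos : 0 < σ₁ := hS.pos _
  have hr0 : (0 : ℝ) < r := by exact_mod_cast hr
  have hr1 : (1 : ℝ) ≤ r := by exact_mod_cast hr
  have hn0 : (0 : ℝ) < n := by exact_mod_cast (by omega : 0 < n)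
  have hrn : r ≤ n := by
    have : (1 : ℝ) ≤ n / r := hμ.trans hμn
    rw [le_div_iff₀ hr0, one_mul] at this
    exact_mod_cast this
  have hκ1 : 1 ≤ κ := by
    rw [hκ, one_le_div hσrpos]
    exact hS.sorted (Fin.mk_le_mk.mpr (Nat.zero_le _))
  have hσκ : σ₁ = κ * σr := by rw [hκ]; field_simp
  have hlog : 1 / 2 ≤ Real.log n := by
    have h1 : Real.log 2 ≤ Real.log n :=
      Real.log_le_log (by norm_num) (by exact_mod_cast hn2)
    linarith [Real.log_two_gt_d9]
  set M : ℝ := μ ^ 2 * (r : ℝ) ^ 3 * κ ^ 2 with hM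
  have hM1 : 1 ≤ M :=
    one_le_mul_of_one_le_of_one_le
      (one_le_mul_of_one_le_of_one_le (one_le_pow₀ hμ) (one_le_pow₀ hr1)) (one_le_pow₀ hκ1)
  -- Rounding up costs at most `1 ≤ 2 log n`, since `n ≥ 2`.
  set q : ℕ := ⌈β * Real.log n⌉₊ with hq
  have hβlog : 0 < β * Real.log n := by nlinarith
  have hqpos : 0 < q := Nat.ceil_pos.mpr hβlog
  have hqlow : β * Real.log n ≤ q := Nat.le_ceil _
  have hqup : (q : ℝ) ≤ (β + 2) * Real.log n := by
    have := (Nat.ceil_lt_add_one hβlog.le).le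
    linarith
  have hexp : 1 ≤ Real.exp 7 := Real.one_le_exp (by norm_num)
  have hnp : 3136 * Real.exp 7 * (M * q) ≤ n * p := by
    have h1 : n * (3136 * Real.exp 7 * (β + 2) * (M * Real.log n / n)) ≤ n * p :=
      mul_le_mul_of_nonneg_left hC hn0.le
    have h2 : n * (3136 * Real.exp 7 * (β + 2) * (M * Real.log n / n)) =
        3136 * Real.exp 7 * (M * ((β + 2) * Real.log n)) := by field_simp
    rw [h2] at h1
    refine le_trans ?_ h1
    gcongr
  have hq0 : (0 : ℝ) < q := by exact_mod_cast hqpos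
  have hqL : (q : ℝ) ≤ n * p := by
    refine le_trans ?_ hnp
    have h1 : (q : ℝ) ≤ M * q := le_mul_of_one_le_left hq0.le hM1
    have h2 : M * q ≤ 3136 * Real.exp 7 * (M * q) :=
      le_mul_of_one_le_left (by positivity) (by linarith)
    linarith
  have hp0 : 0 < p := pos_of_mul_pos_right (hq0.trans_le hqL) hn0.le
  -- Since `n ≥ 2`, there is a pair whose sampling probability is `p`.
  have hp1 : p ≤ 1 := by
    rw [← hδ ⟨(⟨0, by omega⟩, ⟨1, by omega⟩), by simp⟩]
    exact measureReal_le_one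
  set t := Real.sqrt (μ * r * σ₁ / n) with ht
  have ht2 : t ^ 2 = μ * r * σ₁ / n := Real.sq_sqrt (by positivity)
  set τ := σr / (7 * Real.sqrt r) with hτ
  have hsq : Real.sqrt r ^ 2 = r := Real.sq_sqrt hr0.le
  have hτ0 : 0 < τ := by positivity
  have hτ2 : τ ^ 2 = σr ^ 2 / (49 * r) := by rw [hτ, div_pow, mul_pow, hsq]; norm_num
  have hτK : 4 * q * Real.exp 6 * (4 * t ^ 2) ^ 2 * n / p ≤ Real.exp (-1) * τ ^ 2 := by
    have h1 : 4 * q * Real.exp 6 * (4 * t ^ 2) ^ 2 * n / p =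
        3136 * Real.exp 7 * (M * q) / (n * p) * (Real.exp (-1) * τ ^ 2) := by
      have h7 : Real.exp 6 = Real.exp 7 * Real.exp (-1) := by rw [← Real.exp_add]; norm_num
      rw [hτ2, ht2, hσκ, hM, h7]
      field_simp
      ring
    rw [h1]
    refine mul_le_of_le_one_left (by positivity) ?_
    exact (div_le_one (by positivity)).mpr hnp
  have hD : ∀ i j, |EDMC.edm Pstar i j| ≤ 4 * t ^ 2 :=
    EDMC.abs_edm_le fun i => (EDMC.rowNorm_le_normTwoInf Pstar i).trans hinc
  have hbad := EDMC.measureReal_trace_noise_gt_le hm hind hδ hp0 hp1 hD hqpos hqL hτ0 hτK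
  set A : Set S := {ω | ¬ Matrix.trace
    (EDMC.noise p (EDMC.edm Pstar) (fun a => δ a ω) ^ (2 * q)) ≤ τ ^ (2 * q)} with hA
  -- Only the bad event must be measurable, to pass to its complement; the success event enters by
  -- monotonicity.
  have hmA : MeasurableSet A :=
    (measurable_pi_lambda _ hm) (Set.toFinite {d : EDMC.Pairs n → Bool | ¬ Matrix.trace
      (EDMC.noise p (EDMC.edm Pstar) d ^ (2 * q)) ≤ τ ^ (2 * q)}).measurableSet
  have htail : (n : ℝ) * Real.exp (-q) ≤ (n : ℝ) ^ (1 - β) := by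
    rw [Real.rpow_def_of_pos hn0]
    nth_rewrite 1 [← Real.exp_log hn0]
    rw [← Real.exp_add, Real.exp_le_exp]
    linarith
  calc 1 - (n : ℝ) ^ (1 - β) ≤ 1 - Pr.real A := by linarith
    _ = Pr.real Aᶜ := (probReal_compl_eq_one_sub hmA).symm
    _ ≤ _ := measureReal_mono fun ω hω => ?_
  have hω' := not_not.mp hω
  exact EDMC.trim_mem_region_of_quadBound hcI hr hrn (by linarith) hP hS hinc
    (EDMC.quadBound_of_trace_pow_le (EDMC.noise_isSymm p _ _) hτ0.le hqpos.ne' hω')
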